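/- Let $\Omega=(0,1)$ and let $H_0$ be the set-valued Heaviside function, $H_0(s)=\{-1\}$ for $s<0$, $H_0(0)=[-1,1]$, $H_0(s)=\{1\}$ for $s>0$. Let $A_H u=-u_{xx}$ on $L^2(0,1)$, with $D(A_H)=H^2(0,1)\cap H_0^1(0,1)$, and for $r\in\mathbb R$ let $V_H^{2r}=D(A_H^r)$ with norm $\|z\|_{V_H^{2r}}=\|A_H^r z\|_{L^2}$, where $A_H^r$ is the (spectral) fractional power of $A_H$. Let $\mu_1=\pi^2$ be the first eigenvalue of $A_H$ and $e^{-A_Ht}$ the Dirichlet heat semigroup. A strong solution of $$u_t-u_{xx}\in H_0(u)\ \text{ in }(0,1)\times(0,\infty),\qquad u(0,t)=u(1,t)=0,\qquad u(0)=u_0\in L^2(0,1),$$ is a function $u\in C([0,\infty),L^2(0,1))$ with $u(0)=u_0$ that is absolutely continuous on every $[T_1,T_2]\subset(0,\infty)$, with $u(t)\in D(A_H)$ for a.e. $t>0$, and such that for some $g\in L^2_{loc}(0,\infty;L^2(0,1))$ one has $g(t)(x)\in H_0(u(t)(x))$ for a.e. $x\in(0,1)$, for a.e. $t>0$, and $\frac{du}{dt}(t)+A_Hu(t)-g(t)=0$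 for a.e. $t>0$. A fixed point is a constant strong solution. A fixed point $v\in V_H^{2r}$ is asymptotically stable in $V_H^{2r}$ if - (stability) for every $\varepsilon>0$ there is $\gamma>0$ such that every strong solution with $u_0-v\in V_H^{2r}$, $\|u_0-v\|_{V_H^{2r}}<\gamma$ satisfies $u(t)-v\in V_H^{2r}$ and $\|u(t)-v\|_{V_H^{2r}}<\varepsilon$ for all $t\ge 0$; and - (attractivity) there is $\gamma>0$ such that every strong solution with $u_0-v\in V_H^{2r}$, $\|u_0-v\|_{V_H^{2r}}<\gamma$ satisfies $u(t)\to v$ in $V_H^{2r}$ as $t\to+\infty$. Let $v_1^+(x)=-\frac{x^2}{2}+\frac x2$ and $v_1^-=-v_1^+$. **Theorem.** Let $3/4<r<1$ and $v\in\{v_1^+,v_1^-\}$. Then $v$ is a fixed point, $v\in V_H^{2r}$, and $v$ is asymptotically stable in $V_H^{2r}$. Moreover there are $\delta>0$ and $M\ge1$ such that: 1. if $w-v\in V_H^{2r}$ and $\|w-v\|_{V_H^{2r}}<\delta$, then $H_0(w(x))=H_0(v(x))$ for a.e. $x\in(0,1)$; 2. if $z_0\in V_H^{2r}$ and $\|z_0\|_{V_H^{2r}}<\delta$,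 then there is a strong solution with $u(0)=v+z_0$, and every strong solution $u$ with $u(0)=v+z_0$ satisfies, for all $t\ge0$, $u(t)-v\in V_H^{2r}$ and $$u(t)-v=e^{-A_Ht}z_0,\qquad \|u(t)-v\|_{V_H^{2r}}\le M e^{-\mu_1t}\|z_0\|_{V_H^{2r}}.$$ -/

import Mathlib

open Set Filter Topology MeasureTheory
open scoped ContDiff

noncomputable section

namespace DiscRD

/-! ### The space `L²(0,1)` -/

/-- Lebesgue measure on the interval `Ω = (0,1)`. -/
abbrev leb01 : Measure ℝ := volume.restrict (Ioo (0 : ℝ) 1)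

/-- The real Hilbert space `L²(0,1)`. -/
abbrev L2 : Type := Lp ℝ 2 leb01

theorem memLp_of_continuous {f : ℝ → ℝ} (hf : Continuous f) : MemLp f 2 leb01 := by
  obtain ⟨C, hC⟩ := isCompact_Icc.exists_bound_of_continuousOn
    (s := Icc (0 : ℝ) 1) hf.continuousOn
  refine MemLp.of_bound hf.aestronglyMeasurable C ?_
  refine (ae_restrict_iff' measurableSet_Ioo).2 (Eventually.of_forall fun x hx => ?_)
  exact hC x (Ioo_subset_Icc_self hx)

/-- The class in `L²(0,1)` of a continuous function on the line. -/
def toL2 (f : ℝ → ℝ) (hf : Continuous f) : L2 := (memLp_of_continuous hf).toLp f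

theorem toL2_ae (f : ℝ → ℝ) (hf : Continuous f) : toL2 f hf =ᵐ[leb01] f :=
  MemLp.coeFn_toLp _

/-! ### Weak derivatives and the operators `∂ψ¹`, `∂ψ²` -/

/-- Test functions: smooth with compact support inside `(0,1)`. -/
def IsTest (φ : ℝ → ℝ) : Prop :=
  ContDiff ℝ ∞ φ ∧ HasCompactSupport φ ∧ tsupport φ ⊆ Ioo (0 : ℝ) 1

/-- `g ∈ L²(0,1)` is the weak (distributional) derivative of `u ∈ L²(0,1)`. -/
def HasWeakDeriv (u g : L2) : Prop :=
  ∀ φ : ℝ → ℝ, IsTest φ →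
    ∫ x in Ioo (0 : ℝ) 1, u x * deriv φ x = - ∫ x in Ioo (0 : ℝ) 1, g x * φ x

/-- `u ∈ H¹₀(0,1)` with weak derivative `g`: `u` lies in the closure of the test functions
for the `H¹` norm. -/
def HasWeakDerivH10 (u g : L2) : Prop :=
  HasWeakDeriv u g ∧ ∀ ε : ℝ, 0 < ε → ∃ φ : ℝ → ℝ, IsTest φ ∧
    ∫ x in Ioo (0 : ℝ) 1, ((u x - φ x) ^ 2 + (g x - deriv φ x) ^ 2) < ε

/-- The operator `A = A_H = ∂ψ¹`, written as a set-valued map: `y ∈ dirichletLaplacian u` iff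
`u ∈ H²(0,1) ∩ H¹₀(0,1)` and `y = -u''`. Its domain consists of the `u` whose value
is nonempty. -/
def dirichletLaplacian (u : L2) : Set L2 :=
  {y | ∃ p : L2, HasWeakDerivH10 u p ∧ HasWeakDeriv p (-y)}

/-- The set-valued Heaviside function `H₀`. -/
def heaviside (s : ℝ) : Set ℝ :=
  if s < 0 then {-1} else if s = 0 then Icc (-1) 1 else {1}

/-- `∂ψ²(u)`: all the `y ∈ L²(0,1)` with `y(x) ∈ H₀(u(x))` for a.e. `x`. -/
def subdiffPsi2 (u : L2) : Set L2 := {y | ∀ᵐ x ∂leb01, y x ∈ heaviside (u x)}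

/-! ### Strong solutions of `u_t - u_xx ∈ H₀(u)` with Dirichlet conditions -/

/-- `u : [0,∞) → L²(0,1)` is a strong solution with `u(0) = u₀`. Values at negative
times play no role. -/
def IsStrongSolution (u : ℝ → L2) (u₀ : L2) : Prop :=
  ContinuousOn u (Ici 0) ∧ u 0 = u₀ ∧
  (∀ T₁ T₂ : ℝ, 0 < T₁ → T₁ ≤ T₂ → AbsolutelyContinuousOnInterval u T₁ T₂) ∧
  ∃ g : ℝ → L2,
    (∀ T₁ T₂ : ℝ, 0 < T₁ → T₁ ≤ T₂ → MemLp g 2 (volume.restrict (Icc T₁ T₂))) ∧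
    (∀ᵐ t ∂(volume.restrict (Ioi (0 : ℝ))), g t ∈ subdiffPsi2 (u t)) ∧
    ∀ᵐ t ∂(volume.restrict (Ioi (0 : ℝ))),
      ∃ y ∈ dirichletLaplacian (u t), HasDerivAt u (g t - y) t

/-- A fixed point is a constant strong solution. -/
def IsFixedPoint (v : L2) : Prop := IsStrongSolution (fun _ => v) v

/-- `v₁⁺(x) = -x²/2 + x/2`. -/
def v1Plus : L2 := toL2 (fun x => -x ^ 2 / 2 + x / 2) (by fun_prop)

/-- `v₁⁻ = -v₁⁺`. -/
def v1Minus : L2 := -v1Plus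

/-! ### Spectral calculus of the Dirichlet Laplacian -/

/-- The eigenvalues of `A_H`: `μ_{k+1} = ((k+1)π)²`, `k = 0, 1, 2, …`. -/
def dirichletEigenvalue (k : ℕ) : ℝ := ((k + 1 : ℝ) * Real.pi) ^ 2

/-- The orthonormal eigenfunctions of `A_H`: `√2 sin((k+1)πx)`, `k = 0, 1, 2, …`. -/
def dirichletEigenfunction (k : ℕ) : L2 :=
  toL2 (fun x => √2 * Real.sin ((k + 1 : ℝ) * Real.pi * x)) (by fun_prop)

/-! The functions `eₖ` are orthonormal, and they are eigenvectors of `A_H`. -/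

theorem integral_leb01 (f : ℝ → ℝ) : ∫ x, f x ∂leb01 = ∫ x in (0:ℝ)..1, f x := by
  rw [intervalIntegral.integral_of_le zero_le_one, integral_Ioc_eq_integral_Ioo]

theorem integral_cos_nat (n : ℤ) (hn : n ≠ 0) :
    ∫ x in (0:ℝ)..1, Real.cos (n * Real.pi * x) = 0 := by
  have hc : (n : ℝ) * Real.pi ≠ 0 := by
    have := Real.pi_ne_zero; positivity
  rw [intervalIntegral.integral_comp_mul_left (fun y => Real.cos y) hc]
  simp [Real.sin_int_mul_pi]

theorem inner_toL2 (f g : ℝ → ℝ) (hf : Continuous f) (hg : Continuous g) :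
    inner ℝ (toL2 f hf) (toL2 g hg) = ∫ x in (0:ℝ)..1, f x * g x := by
  rw [L2.inner_def, ← integral_leb01]
  refine integral_congr_ae ?_
  filter_upwards [toL2_ae f hf, toL2_ae g hg] with x h1 h2
  simp [h1, h2, mul_comm]

theorem orthonormal_dirichletEigenfunction : Orthonormal ℝ dirichletEigenfunction := by
  rw [orthonormal_iff_ite]
  intro i j
  rw [dirichletEigenfunction, dirichletEigenfunction, inner_toL2]
  have h2 : √2 * √2 = (2 : ℝ) := Real.mul_self_sqrt (by norm_num)
  have key : ∀ x : ℝ, √2 * Real.sin ((i + 1 : ℝ) * Real.pi * x) *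
      (√2 * Real.sin ((j + 1 : ℝ) * Real.pi * x)) =
      Real.cos (((i - j : ℤ) : ℝ) * Real.pi * x) -
        Real.cos (((i + j + 2 : ℤ) : ℝ) * Real.pi * x) := by
    intro x
    have e1 : ((i - j : ℤ) : ℝ) * Real.pi * x =
      (i + 1 : ℝ) * Real.pi * x - (j + 1 : ℝ) * Real.pi * x := by push_cast; ring
    have e2 : ((i + j + 2 : ℤ) : ℝ) * Real.pi * x =
      (i + 1 : ℝ) * Real.pi * x + (j + 1 : ℝ) * Real.pi * x := by push_cast; ring
    rw [e1, e2, Real.cos_sub, Real.cos_add]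
    linear_combination (Real.sin ((i + 1 : ℝ) * Real.pi * x) *
      Real.sin ((j + 1 : ℝ) * Real.pi * x)) * h2
  simp_rw [key]
  rw [intervalIntegral.integral_sub (Continuous.intervalIntegrable (by fun_prop) _ _)
    (Continuous.intervalIntegrable (by fun_prop) _ _),
    integral_cos_nat (i + j + 2) (by omega)]
  split_ifs with h
  · subst h; simp
  · rw [integral_cos_nat (i - j) (by omega)]; simp

theorem IsTest.eq_zero {φ : ℝ → ℝ} (h : IsTest φ) {x : ℝ} (hx : x ∉ Ioo (0 : ℝ) 1) :
    φ x = 0 := by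
  by_contra hne
  exact hx (h.2.2 (subset_tsupport _ hne))

theorem hasWeakDeriv_toL2 {f f' : ℝ → ℝ} (hf : Continuous f) (hf' : Continuous f')
    (hd : ∀ x, HasDerivAt f (f' x) x) : HasWeakDeriv (toL2 f hf) (toL2 f' hf') := by
  intro φ hφ
  have hφd : ∀ x, HasDerivAt φ (deriv φ x) x := fun x =>
    ((hφ.1.differentiable (by simp)) x).hasDerivAt
  have hφc : Continuous (deriv φ) := hφ.1.continuous_deriv (by simp)
  have e1 : ∫ x in Ioo (0 : ℝ) 1, toL2 f hf x * deriv φ x =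
      ∫ x in (0 : ℝ)..1, f x * deriv φ x := by
    rw [← integral_leb01]
    refine integral_congr_ae ?_
    filter_upwards [toL2_ae f hf] with x h1
    rw [h1]
  have e2 : ∫ x in Ioo (0 : ℝ) 1, toL2 f' hf' x * φ x =
      ∫ x in (0 : ℝ)..1, f' x * φ x := by
    rw [← integral_leb01]
    refine integral_congr_ae ?_
    filter_upwards [toL2_ae f' hf'] with x h1
    rw [h1]
  rw [e1, e2, intervalIntegral.integral_mul_deriv_eq_deriv_mul (fun x _ => hd x)
    (fun x _ => hφd x) (hf'.intervalIntegrable _ _) (hφc.intervalIntegrable _ _),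
    hφ.eq_zero (x := 1) (by simp), hφ.eq_zero (x := 0) (by simp)]
  simp

/-- A smooth cutoff, equal to `1` on `[2/n, 1 - 2/n]` and to `0` outside `[1/n, 1 - 1/n]`. -/
def cutoff (n : ℕ) (x : ℝ) : ℝ :=
  Real.smoothTransition (n * x - 1) * Real.smoothTransition (n * (1 - x) - 1)

theorem cutoff_contDiff (n : ℕ) : ContDiff ℝ ∞ (cutoff n) := by
  unfold cutoff
  exact (Real.smoothTransition.contDiff.comp (by fun_prop)).mul
    (Real.smoothTransition.contDiff.comp (by fun_prop))

theorem exists_bound_deriv_smoothTransition :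
    ∃ C : ℝ, 0 ≤ C ∧ ∀ y, |deriv Real.smoothTransition y| ≤ C := by
  have hc : Continuous (deriv Real.smoothTransition) :=
    (Real.smoothTransition.contDiff (n := 1)).continuous_deriv le_rfl
  obtain ⟨C, hC⟩ := isCompact_Icc.exists_bound_of_continuousOn (s := Icc (0:ℝ) 1) hc.continuousOn
  refine ⟨C, (norm_nonneg _).trans (hC 0 (by simp)), fun y => ?_⟩
  by_cases hy : y ∈ Icc (0:ℝ) 1
  · exact hC y hy
  · have h0 : deriv Real.smoothTransition y = 0 := by
      rw [mem_Icc, not_and_or, not_le, not_le] at hy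
      rcases hy with hy | hy
      · have : Real.smoothTransition =ᶠ[𝓝 y] fun _ => 0 := by
          filter_upwards [Iio_mem_nhds hy] with z hz
          exact Real.smoothTransition.zero_of_nonpos (le_of_lt hz)
        rw [this.deriv_eq]; simp
      · have : Real.smoothTransition =ᶠ[𝓝 y] fun _ => 1 := by
          filter_upwards [Ioi_mem_nhds hy] with z hz
          exact Real.smoothTransition.one_of_one_le (le_of_lt hz)
        rw [this.deriv_eq]; simp
    rw [h0]; simpa using (norm_nonneg _).trans (hC 0 (by simp))


theorem deriv_smoothTransition_of_one_lt {y : ℝ} (hy : 1 < y) :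
    deriv Real.smoothTransition y = 0 := by
  have : Real.smoothTransition =ᶠ[𝓝 y] fun _ => 1 := by
    filter_upwards [Ioi_mem_nhds hy] with z hz
    exact Real.smoothTransition.one_of_one_le (le_of_lt hz)
  rw [this.deriv_eq]; simp

theorem isTest_mul_cutoff {f : ℝ → ℝ} (hf : ContDiff ℝ ∞ f) (n : ℕ) :
    IsTest (fun x => f x * cutoff (n + 1) x) := by
  have hpos : (0 : ℝ) < (n : ℝ) + 1 := by positivity
  have hsub : tsupport (fun x => f x * cutoff (n + 1) x) ⊆
      Icc (1 / ((n : ℝ) + 1)) (1 - 1 / ((n : ℝ) + 1)) := by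
    refine closure_minimal ?_ isClosed_Icc
    intro x hx
    by_contra hne
    apply hx
    have : cutoff (n + 1) x = 0 := by
      rw [mem_Icc, not_and_or, not_le, not_le] at hne
      unfold cutoff
      push_cast
      rcases hne with h | h
      · rw [Real.smoothTransition.zero_of_nonpos, zero_mul]
        rw [lt_div_iff₀ hpos] at h; linarith
      · rw [Real.smoothTransition.zero_of_nonpos (x := _ * (1 - x) - 1), mul_zero]
        have h' : 1 - x < 1 / ((n : ℝ) + 1) := by linarith
        rw [lt_div_iff₀ hpos] at h'; linarith
    simp [this]
  refine ⟨hf.mul (cutoff_contDiff _), ?_, hsub.trans ?_⟩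
  · exact IsCompact.of_isClosed_subset isCompact_Icc (isClosed_tsupport _) hsub
  · intro x hx
    have : (0 : ℝ) < 1 / ((n : ℝ) + 1) := by positivity
    exact ⟨by linarith [hx.1], by linarith [hx.2]⟩

theorem hasDerivAt_cutoff (n : ℕ) (x : ℝ) : HasDerivAt (cutoff n)
    (deriv Real.smoothTransition (n * x - 1) * n * Real.smoothTransition (n * (1 - x) - 1) +
      Real.smoothTransition (n * x - 1) *
        (deriv Real.smoothTransition (n * (1 - x) - 1) * (-n))) x := by
  have hS : ∀ y, HasDerivAt Real.smoothTransition (deriv Real.smoothTransition y) y := fun y =>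
    (((Real.smoothTransition.contDiff (n := 1)).differentiable (by simp)) y).hasDerivAt
  have h1 : HasDerivAt (fun x : ℝ => n * x - 1) (n : ℝ) x := by
    simpa using ((hasDerivAt_id x).const_mul (n : ℝ)).sub_const 1
  have h2 : HasDerivAt (fun x : ℝ => n * (1 - x) - 1) (-n : ℝ) x := by
    simpa using ((((hasDerivAt_id x).const_sub 1)).const_mul (n : ℝ)).sub_const 1
  exact ((hS _).comp x h1).mul ((hS _).comp x h2)

theorem hasWeakDerivH10_toL2 {f f' : ℝ → ℝ} (hf : ContDiff ℝ ∞ f) (hf' : Continuous f')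
    (hd : ∀ x, HasDerivAt f (f' x) x) (h0 : f 0 = 0) (h1 : f 1 = 0) :
    HasWeakDerivH10 (toL2 f hf.continuous) (toL2 f' hf') := by
  refine ⟨hasWeakDeriv_toL2 _ _ hd, fun ε hε => ?_⟩
  obtain ⟨F, hF⟩ := isCompact_Icc.exists_bound_of_continuousOn
    (s := Icc (0:ℝ) 1) hf.continuous.continuousOn
  obtain ⟨K, hK⟩ := isCompact_Icc.exists_bound_of_continuousOn
    (s := Icc (0:ℝ) 1) hf'.continuousOn
  obtain ⟨C, hC0, hC⟩ := exists_bound_deriv_smoothTransition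
  have hK0 : 0 ≤ K := (norm_nonneg _).trans (hK 0 (by simp))
  have hlip : ∀ x ∈ Icc (0:ℝ) 1, ∀ y ∈ Icc (0:ℝ) 1, |f y - f x| ≤ K * |y - x| := by
    intro x hx y hy
    exact (convex_Icc (0:ℝ) 1).norm_image_sub_le_of_norm_hasDerivWithin_le
      (fun z _ => (hd z).hasDerivWithinAt) hK hx hy
  have hS0 := Real.smoothTransition.nonneg
  have hS1 := Real.smoothTransition.le_one
  set D : ℕ → ℝ → ℝ := fun n x =>
    (f x - f x * cutoff (n + 1) x) ^ 2 +
      (f' x - deriv (fun x => f x * cutoff (n + 1) x) x) ^ 2 with hD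
  have hderiv : ∀ n x, deriv (fun x => f x * cutoff (n + 1) x) x =
      f' x * cutoff (n + 1) x + f x * deriv (cutoff (n + 1)) x := fun n x => by
    have hc := hasDerivAt_cutoff (n + 1) x
    rw [hc.deriv]
    exact ((hd x).mul hc).deriv
  have hdb : ∀ n x, x ∈ Ioo (0:ℝ) 1 → |f x * deriv (cutoff (n + 1)) x| ≤ 4 * K * C := by
    intro n x hx
    have hxI := Ioo_subset_Icc_self hx
    have hN : (0:ℝ) < ((n + 1 : ℕ) : ℝ) := by positivity
    have b0 : |f x| ≤ K * x := by
      have := hlip 0 (by simp) x hxI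
      rwa [h0, sub_zero, sub_zero, abs_of_pos hx.1] at this
    have b1 : |f x| ≤ K * (1 - x) := by
      have := hlip 1 (by simp) x hxI
      rwa [h1, sub_zero, abs_sub_comm x 1, abs_of_pos (sub_pos.2 hx.2)] at this
    have aux : ∀ s : ℝ, 0 ≤ s → |f x| ≤ K * s → ∀ q : ℝ, 0 ≤ q → q ≤ 1 →
        |f x| * (|deriv Real.smoothTransition (((n + 1 : ℕ) : ℝ) * s - 1)| * ((n + 1 : ℕ) : ℝ) * q)
          ≤ 2 * K * C := by
      intro s hs hb q hq0 hq1
      by_cases hlt : 1 < ((n + 1 : ℕ) : ℝ) * s - 1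
      · rw [deriv_smoothTransition_of_one_lt hlt]
        simp only [abs_zero, zero_mul, mul_zero]; positivity
      · have hle : ((n + 1 : ℕ) : ℝ) * s ≤ 2 := by linarith
        calc _ ≤ (K * s) * (C * ((n + 1 : ℕ) : ℝ) * 1) := by
              gcongr
              exact hC _
          _ = (K * C) * (((n + 1 : ℕ) : ℝ) * s) := by ring
          _ ≤ (K * C) * 2 := by gcongr
          _ = _ := by ring
    rw [(hasDerivAt_cutoff (n + 1) x).deriv, mul_add]
    refine (abs_add_le _ _).trans ?_
    have a1 := aux x hx.1.le b0 _ (hS0 (((n + 1 : ℕ) : ℝ) * (1 - x) - 1)) (hS1 _)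
    have a2 := aux (1 - x) (sub_pos.2 hx.2).le b1 _ (hS0 (((n + 1 : ℕ) : ℝ) * x - 1)) (hS1 _)
    simp only [abs_mul, abs_neg, abs_of_nonneg hN.le, abs_of_nonneg (hS0 _)]
    linarith
  have hη : ∀ n x, 0 ≤ cutoff n x ∧ cutoff n x ≤ 1 := fun n x =>
    ⟨mul_nonneg (hS0 _) (hS0 _), mul_le_one₀ (hS1 _) (hS0 _) (hS1 _)⟩
  have hlim : Tendsto (fun n => ∫ x, D n x ∂leb01) atTop (𝓝 (∫ x, (0 : ℝ) ∂leb01)) := by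
    refine tendsto_integral_of_dominated_convergence
      (fun _ => F ^ 2 + (K + 4 * K * C) ^ 2) ?_ (integrable_const _) ?_ ?_
    · intro n
      have hc : Continuous (deriv (fun x => f x * cutoff (n + 1) x)) :=
        (isTest_mul_cutoff hf n).1.continuous_deriv (by simp)
      have hfc := hf.continuous
      have hcc := (cutoff_contDiff (n + 1)).continuous
      exact Continuous.aestronglyMeasurable (by fun_prop)
    · intro n
      refine (ae_restrict_iff' measurableSet_Ioo).2 (Eventually.of_forall fun x hx => ?_)
      have hxI := Ioo_subset_Icc_self hx
      obtain ⟨e0, e1⟩ := hη (n + 1) x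
      rw [Real.norm_of_nonneg (by positivity), hD]
      have A1 : |f x - f x * cutoff (n + 1) x| ≤ F := by
        rw [← mul_one_sub, abs_mul, abs_of_nonneg (sub_nonneg.2 e1)]
        exact (mul_le_of_le_one_right (abs_nonneg _) (by linarith)).trans (hF x hxI)
      have A2 : |f' x - deriv (fun x => f x * cutoff (n + 1) x) x| ≤ K + 4 * K * C := by
        rw [hderiv]
        have : f' x - (f' x * cutoff (n + 1) x + f x * deriv (cutoff (n + 1)) x) =
          f' x * (1 - cutoff (n + 1) x) - f x * deriv (cutoff (n + 1)) x := by ring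
        rw [this]
        refine (abs_sub _ _).trans (add_le_add ?_ (hdb n x hx))
        rw [abs_mul, abs_of_nonneg (sub_nonneg.2 e1)]
        exact (mul_le_of_le_one_right (abs_nonneg _) (by linarith)).trans (hK x hxI)
      exact add_le_add (sq_le_sq' (neg_le_of_abs_le A1) (le_of_abs_le A1))
        (sq_le_sq' (neg_le_of_abs_le A2) (le_of_abs_le A2))
    · refine (ae_restrict_iff' measurableSet_Ioo).2 (Eventually.of_forall fun x hx => ?_)
      refine tendsto_const_nhds.congr' ?_
      have t1 : Tendsto (fun n : ℕ => ((n + 1 : ℕ) : ℝ) * x) atTop atTop :=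
        ((tendsto_natCast_atTop_atTop (R := ℝ)).comp (tendsto_add_atTop_nat 1)).atTop_mul_const hx.1
      have t2 : Tendsto (fun n : ℕ => ((n + 1 : ℕ) : ℝ) * (1 - x)) atTop atTop :=
        ((tendsto_natCast_atTop_atTop (R := ℝ)).comp
          (tendsto_add_atTop_nat 1)).atTop_mul_const (sub_pos.2 hx.2)
      filter_upwards [t1.eventually_gt_atTop 2, t2.eventually_gt_atTop 2] with n hn1 hn2
      have c1 : cutoff (n + 1) x = 1 := by
        unfold cutoff
        rw [Real.smoothTransition.one_of_one_le (by linarith),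
          Real.smoothTransition.one_of_one_le (by linarith), one_mul]
      have c2 : deriv (cutoff (n + 1)) x = 0 := by
        rw [(hasDerivAt_cutoff (n + 1) x).deriv,
          deriv_smoothTransition_of_one_lt (by linarith),
          deriv_smoothTransition_of_one_lt (by linarith)]
        simp
      simp only [hD]
      rw [hderiv, c1, c2]; simp
  rw [integral_zero] at hlim
  obtain ⟨n, hn⟩ := (hlim.eventually_lt_const hε).exists
  refine ⟨_, isTest_mul_cutoff hf n, lt_of_eq_of_lt (integral_congr_ae ?_) hn⟩
  filter_upwards [toL2_ae f hf.continuous, toL2_ae f' hf'] with x e1 e2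
  rw [e1, e2]

/-- `eₖ ∈ D(A_H)` and `A_H eₖ = μₖ eₖ`. -/
theorem dirichletEigenfunction_mem (k : ℕ) :
    dirichletEigenvalue k • dirichletEigenfunction k ∈
      dirichletLaplacian (dirichletEigenfunction k) := by
  set a : ℝ := (k + 1 : ℝ) * Real.pi with ha
  have hlin : ∀ x : ℝ, HasDerivAt (fun x : ℝ => a * x) a x := fun x => by
    simpa using (hasDerivAt_id x).const_mul a
  have hs1 : Real.sin a = 0 := by
    have := Real.sin_nat_mul_pi (k + 1); push_cast at this; exact this
  have d1 : ∀ x : ℝ, HasDerivAt (fun x => √2 * Real.sin (a * x))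
      (√2 * a * Real.cos (a * x)) x := fun x => by
    convert! ((hlin x).sin).const_mul √2 using 1; ring
  have d2 : ∀ x : ℝ, HasDerivAt (fun x => √2 * a * Real.cos (a * x))
      (-(a ^ 2 * (√2 * Real.sin (a * x)))) x := fun x => by
    convert! ((hlin x).cos).const_mul (√2 * a) using 1; ring
  refine ⟨toL2 (fun x => √2 * a * Real.cos (a * x)) (by fun_prop),
    hasWeakDerivH10_toL2 (by fun_prop) _ d1 (by simp) (by simpa [ha] using hs1), ?_⟩
  have e : -(dirichletEigenvalue k • dirichletEigenfunction k) =
      toL2 (fun x => -(a ^ 2 * (√2 * Real.sin (a * x)))) (by fun_prop) := by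
    apply Lp.ext
    filter_upwards [Lp.coeFn_neg (dirichletEigenvalue k • dirichletEigenfunction k),
      Lp.coeFn_smul (dirichletEigenvalue k) (dirichletEigenfunction k),
      toL2_ae (fun x => √2 * Real.sin ((k + 1 : ℝ) * Real.pi * x)) (by fun_prop),
      toL2_ae (fun x => -(a ^ 2 * (√2 * Real.sin (a * x)))) (by fun_prop)] with x h1 h2 h3 h4
    rw [h1, Pi.neg_apply, h2, h4, Pi.smul_apply, dirichletEigenfunction, h3]
    simp [dirichletEigenvalue, ha]
  rw [e]
  exact hasWeakDeriv_toL2 _ _ d2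

/-- The `k`-th Fourier coefficient of `u` in the basis of eigenfunctions. -/
def dirichletCoeff (k : ℕ) (u : L2) : ℝ := inner ℝ (dirichletEigenfunction k) u

/-- The space `V_H^{2r} = D(A_H^r)`: all the `u ∈ L²(0,1)` for which the series
`∑ₖ μₖ^r (u, eₖ) eₖ` converges in `L²(0,1)`. -/
def VH (r : ℝ) : Submodule ℝ L2 where
  carrier := {u | Summable fun k : ℕ =>
    (dirichletEigenvalue k ^ r * dirichletCoeff k u) • dirichletEigenfunction k}
  add_mem' := by
    intro u w hu hw
    simp only [mem_ofPred_eq] at hu hw ⊢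
    simpa only [dirichletCoeff, inner_add_right, mul_add, add_smul] using hu.add hw
  zero_mem' := by
    simp only [mem_ofPred_eq, dirichletCoeff, inner_zero_right, mul_zero, zero_smul]
    exact summable_zero
  smul_mem' := by
    intro c u hu
    simp only [mem_ofPred_eq] at hu ⊢
    simpa only [dirichletCoeff, inner_smul_right, smul_smul, mul_left_comm] using
      hu.const_smul c

/-- The fractional power `A_H^r u = ∑ₖ μₖ^r (u, eₖ) eₖ` on its domain `D(A_H^r)`. -/
def dirichletPow (r : ℝ) (u : VH r) : L2 :=
  ∑' k : ℕ, (dirichletEigenvalue k ^ r * dirichletCoeff k (u : L2)) • dirichletEigenfunction k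

/-- The norm `‖z‖_{V_H^{2r}} = ‖A_H^r z‖_{L²}`. -/
def normVH (r : ℝ) (z : VH r) : ℝ := ‖dirichletPow r z‖

/-- The open ball `O_δ(v)` of `V_H^{2r}`. -/
def ballVH (r : ℝ) (v : L2) (δ : ℝ) : Set L2 :=
  {w | ∃ z : VH r, w = v + z ∧ normVH r z < δ}

/-- The Dirichlet heat semigroup `e^{-A_H t} z = ∑ₖ e^{-μₖ t} (z, eₖ) eₖ`, `t ≥ 0`. -/
def heatSemigroup (t : ℝ) (z : L2) : L2 :=
  ∑' k : ℕ, (Real.exp (-dirichletEigenvalue k * t) * dirichletCoeff k z) •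
    dirichletEigenfunction k

theorem heatSemigroup_hasSum (t : ℝ) (ht : 0 ≤ t) (z : L2) :
    HasSum (fun k : ℕ => (Real.exp (-dirichletEigenvalue k * t) * dirichletCoeff k z) •
      dirichletEigenfunction k) (heatSemigroup t z) := by
  refine Summable.hasSum ?_
  have h := orthonormal_dirichletEigenfunction
  refine (h.orthogonalFamily.summable_iff_norm_sq_summable
    (fun k => (Real.exp (-dirichletEigenvalue k * t) * dirichletCoeff k z))).2 ?_
  refine (h.inner_products_summable (x := z)).of_nonneg_of_le (fun _ => by positivity) ?_
  intro k
  have : Real.exp (-dirichletEigenvalue k * t) ≤ 1 := by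
    rw [Real.exp_le_one_iff]
    have : 0 ≤ dirichletEigenvalue k := by unfold dirichletEigenvalue; positivity
    nlinarith
  rw [norm_mul, Real.norm_eq_abs (Real.exp _), abs_of_pos (Real.exp_pos _)]
  gcongr
  exact mul_le_of_le_one_left (norm_nonneg _) this

/-! ### Stability in `V_H^{2r}` -/

/-- Lyapunov stability in `V_H^{2r}`: every solution that starts close to `v` in `V_H^{2r}`
stays in `V_H^{2r}`, close to `v`, for all `t ≥ 0`. -/
def IsStableVH (r : ℝ) (v : L2) : Prop :=
  ∀ ε : ℝ, 0 < ε → ∃ γ : ℝ, 0 < γ ∧ ∀ u₀ ∈ ballVH r v γ, ∀ u : ℝ → L2,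
    IsStrongSolution u u₀ → ∀ t : ℝ, 0 ≤ t → u t ∈ ballVH r v ε

/-- Local attractivity in `V_H^{2r}`: every solution that starts close to `v` in `V_H^{2r}`
converges to `v` in `V_H^{2r}` as `t → ∞`. -/
def IsAttractiveVH (r : ℝ) (v : L2) : Prop :=
  ∃ γ : ℝ, 0 < γ ∧ ∀ u₀ ∈ ballVH r v γ, ∀ u : ℝ → L2,
    IsStrongSolution u u₀ → ∀ ε : ℝ, 0 < ε → ∀ᶠ t in atTop, u t ∈ ballVH r v ε

/-- `v` is an asymptotically stable fixed point in `V_H^{2r}`. -/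
def IsAsymptoticallyStableVH (r : ℝ) (v : L2) : Prop :=
  IsFixedPoint v ∧ v ∈ VH r ∧ IsStableVH r v ∧ IsAttractiveVH r v

end DiscRD

end

noncomputable section

namespace DiscRD

/-! ### Weak derivatives as closed subspaces of `L² × L²` -/

/-! The profile `v₁⁺ = x(1 - x)/2` is positive and satisfies `A_H v = 1`, so as long as a perturbed
solution stays positive its source is the constant `1` and the perturbation solves the plain heat
equation. The proof makes this region of positivity a ball of `V_H^{2r}` that the heat flow
preserves.

Positivity up to the boundary needs `|z|` bounded by a multiple of `x(1 - x)`. This follows from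
`|sin((k+1)πx)| ≤ (k+1) sin(πx)` once `∑ (k+1)|c_k|` is finite, which Cauchy–Schwarz gives because
`∑ k² μ_k^{-2r}` converges exactly for `r > 3/4` (`exists_ae_abs_le_normVH`). The semigroup
multiplies each mode by at most `e^{-μ₁ t}`, so `v + e^{-A_H t} z₀` stays above `x(1 - x)/4` and is
a strong solution (`isStrongSolution_add_heatSemigroup`).

The delicate point is uniqueness: `H₀` jumps upwards, so the source has no one-sided Lipschitz
bound. Against a solution `u₂ ≥ c x(1 - x)`, the sources differ only where the other solution is
nonpositive, and there the difference `w` satisfies `|w| ≥ c x(1 - x)`. Hence the reaction term is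
at most `2w²/(c x(1 - x))`. Near the boundary `w² ≤ min(x, 1 - x) ‖w_x‖²` cancels the singular
weight, and a thin enough layer is absorbed by the dissipation; elsewhere the weight is bounded.
Grönwall concludes (`inner_sub_le_of_subdiffPsi2`, `IsStrongSolution.eq_of_lower_bound`). Oddness of
`H₀` transfers everything to `v₁⁻`. -/

theorem inner_toL2_right (u : L2) (f : ℝ → ℝ) (hf : Continuous f) :
    inner ℝ u (toL2 f hf) = ∫ x in Ioo (0 : ℝ) 1, u x * f x := by
  rw [L2.inner_def]
  refine integral_congr_ae ?_
  filter_upwards [toL2_ae f hf] with x h1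
  simp [h1, mul_comm]

theorem IsTest.continuous_deriv {φ : ℝ → ℝ} (h : IsTest φ) : Continuous (deriv φ) :=
  h.1.continuous_deriv (by simp)

theorem IsTest.differentiable {φ : ℝ → ℝ} (h : IsTest φ) : Differentiable ℝ φ :=
  h.1.differentiable (by simp)

theorem IsTest.zero : IsTest (fun _ => 0) := by
  refine ⟨contDiff_const, HasCompactSupport.zero, ?_⟩
  have : tsupport (fun _ : ℝ => (0 : ℝ)) = ∅ := tsupport_eq_empty_iff.2 rfl
  simp [this]

theorem IsTest.add {φ ψ : ℝ → ℝ} (h : IsTest φ) (h' : IsTest ψ) : IsTest (φ + ψ) :=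
  ⟨h.1.add h'.1, h.2.1.add h'.2.1, (tsupport_add φ ψ).trans (union_subset h.2.2 h'.2.2)⟩

theorem IsTest.smul {φ : ℝ → ℝ} (c : ℝ) (h : IsTest φ) : IsTest (c • φ) :=
  ⟨h.1.const_smul c, h.2.1.smul_left (f := fun _ => c),
    (tsupport_smul_subset_right (fun _ => c) φ).trans h.2.2⟩

theorem toL2_add {f g : ℝ → ℝ} (hf : Continuous f) (hg : Continuous g) :
    toL2 (f + g) (hf.add hg) = toL2 f hf + toL2 g hg := MemLp.toLp_add _ _

theorem toL2_smul {f : ℝ → ℝ} (c : ℝ) (hf : Continuous f) :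
    toL2 (c • f) (hf.const_smul c) = c • toL2 f hf := MemLp.toLp_const_smul _ _

theorem toL2_congr {f g : ℝ → ℝ} (hf : Continuous f) (hg : Continuous g) (h : f = g) :
    toL2 f hf = toL2 g hg := by subst h; rfl

/-- In this form the weak derivative is a family of continuous linear conditions on the pair, hence
a closed subspace. -/
theorem hasWeakDeriv_iff {u g : L2} : HasWeakDeriv u g ↔
    ∀ (φ : ℝ → ℝ) (h : IsTest φ),
      inner ℝ u (toL2 (deriv φ) h.continuous_deriv) +
        inner ℝ g (toL2 φ h.1.continuous) = 0 := by
  simp only [HasWeakDeriv, inner_toL2_right, eq_neg_iff_add_eq_zero]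

/-- The graph of the weak derivative. -/
def weakDerivGraph : Submodule ℝ (L2 × L2) where
  carrier := {q | HasWeakDeriv q.1 q.2}
  add_mem' := by
    intro a b ha hb
    simp only [mem_ofPred_eq, hasWeakDeriv_iff, Prod.fst_add, Prod.snd_add, inner_add_left]
      at ha hb ⊢
    intro φ h
    linear_combination ha φ h + hb φ h
  zero_mem' := by
    simp [hasWeakDeriv_iff]
  smul_mem' := by
    intro c a ha
    simp only [mem_ofPred_eq, hasWeakDeriv_iff, Prod.smul_fst, Prod.smul_snd,
      real_inner_smul_left] at ha ⊢
    intro φ h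
    linear_combination c * ha φ h

theorem isClosed_weakDerivGraph : IsClosed (weakDerivGraph : Set (L2 × L2)) := by
  have : (weakDerivGraph : Set (L2 × L2)) = ⋂ (φ : ℝ → ℝ) (h : IsTest φ),
      {q : L2 × L2 | inner ℝ q.1 (toL2 (deriv φ) h.continuous_deriv) +
        inner ℝ q.2 (toL2 φ h.1.continuous) = 0} := by
    ext q
    simp only [SetLike.mem_coe, mem_iInter]
    exact hasWeakDeriv_iff
  rw [this]
  refine isClosed_iInter fun φ => isClosed_iInter fun h => ?_
  exact isClosed_eq (by fun_prop) continuous_const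

/-- The pairs of a test function and its derivative. -/
def testGraph : Submodule ℝ (L2 × L2) where
  carrier := {q | ∃ (φ : ℝ → ℝ) (h : IsTest φ),
    q = (toL2 φ h.1.continuous, toL2 (deriv φ) h.continuous_deriv)}
  add_mem' := by
    rintro _ _ ⟨φ, h, rfl⟩ ⟨ψ, h', rfl⟩
    refine ⟨φ + ψ, h.add h', ?_⟩
    rw [Prod.mk_add_mk, ← toL2_add, ← toL2_add]
    refine Prod.ext rfl (toL2_congr (h.continuous_deriv.add h'.continuous_deriv)
      (h.add h').continuous_deriv ?_)
    ext x
    exact (deriv_add (h.differentiable x) (h'.differentiable x)).symm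
  zero_mem' := by
    refine ⟨_, IsTest.zero, ?_⟩
    have h0 : ∀ h : Continuous (fun _ : ℝ => (0 : ℝ)), toL2 (fun _ => 0) h = 0 := fun h =>
      MemLp.toLp_zero _
    refine Prod.ext (h0 continuous_const).symm ?_
    refine (h0 continuous_const).symm.trans (a := (0 : L2))
      (toL2_congr _ IsTest.zero.continuous_deriv ?_)
    simp
  smul_mem' := by
    rintro c _ ⟨φ, h, rfl⟩
    refine ⟨c • φ, h.smul c, ?_⟩
    rw [Prod.smul_mk, ← toL2_smul, ← toL2_smul]
    refine Prod.ext rfl (toL2_congr (h.continuous_deriv.const_smul c)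
      (h.smul c).continuous_deriv ?_)
    ext x
    exact (deriv_const_smul c (h.differentiable x)).symm

theorem testGraph_le_weakDerivGraph : testGraph ≤ weakDerivGraph := by
  rintro _ ⟨φ, h, rfl⟩
  exact hasWeakDeriv_toL2 h.1.continuous h.continuous_deriv
    fun x => (h.differentiable x).hasDerivAt

theorem norm_sq_L2 (u : L2) : ‖u‖ ^ 2 = ∫ x, u x ^ 2 ∂leb01 := by
  rw [← real_inner_self_eq_norm_sq, L2.inner_def]
  refine integral_congr_ae (Eventually.of_forall fun x => ?_)
  simp [sq]

theorem integrable_sq_L2 (u : L2) : Integrable (fun x => u x ^ 2) leb01 :=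
  (Lp.memLp u).integrable_sq

/-- Turns the `H¹` error of `HasWeakDerivH10` into norms, so that `H¹₀` becomes a closure in `L2 ×
L2`. -/
theorem integral_sq_sub_toL2 (u g : L2) {f f' : ℝ → ℝ} (hf : Continuous f)
    (hf' : Continuous f') :
    ∫ x in Ioo (0 : ℝ) 1, ((u x - f x) ^ 2 + (g x - f' x) ^ 2) =
      ‖u - toL2 f hf‖ ^ 2 + ‖g - toL2 f' hf'‖ ^ 2 := by
  rw [norm_sq_L2, norm_sq_L2, ← integral_add (integrable_sq_L2 _) (integrable_sq_L2 _)]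
  refine integral_congr_ae ?_
  filter_upwards [toL2_ae f hf, toL2_ae f' hf', Lp.coeFn_sub u (toL2 f hf),
    Lp.coeFn_sub g (toL2 f' hf')] with x h1 h2 h3 h4
  simp only [h3, h4, Pi.sub_apply, h1, h2]

/-- `H¹₀` is the closure of the test functions. -/
theorem hasWeakDerivH10_iff {u p : L2} :
    HasWeakDerivH10 u p ↔ (u, p) ∈ testGraph.topologicalClosure := by
  rw [← SetLike.mem_coe, Submodule.topologicalClosure_coe]
  constructor
  · rintro ⟨-, h⟩
    rw [Metric.mem_closure_iff]
    intro ε hε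
    obtain ⟨φ, hφ, hlt⟩ := h (ε ^ 2) (by positivity)
    rw [integral_sq_sub_toL2 u p hφ.1.continuous hφ.continuous_deriv] at hlt
    refine ⟨_, ⟨φ, hφ, rfl⟩, ?_⟩
    rw [Prod.dist_eq, dist_eq_norm, dist_eq_norm]
    refine max_lt ?_ ?_
    · exact lt_of_pow_lt_pow_left₀ 2 hε.le
        ((le_add_of_nonneg_right (sq_nonneg _)).trans_lt hlt)
    · exact lt_of_pow_lt_pow_left₀ 2 hε.le
        ((le_add_of_nonneg_left (sq_nonneg _)).trans_lt hlt)
  · intro h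
    refine ⟨closure_minimal testGraph_le_weakDerivGraph isClosed_weakDerivGraph h, ?_⟩
    intro ε hε
    -- The product carries the maximum metric, so radius `√(ε / 2)` puts each of the two squares
    -- below `ε / 2`.
    obtain ⟨_, ⟨φ, hφ, rfl⟩, hlt⟩ := Metric.mem_closure_iff.1 h √(ε / 2) (by positivity)
    refine ⟨φ, hφ, ?_⟩
    rw [integral_sq_sub_toL2 u p hφ.1.continuous hφ.continuous_deriv]
    rw [Prod.dist_eq, dist_eq_norm, dist_eq_norm, max_lt_iff,
      Real.lt_sqrt (norm_nonneg _), Real.lt_sqrt (norm_nonneg _)] at hlt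
    linarith [hlt.1, hlt.2]

/-- The triples `(u, p, y)` with `u ∈ H¹₀`, weak derivative `p`, and `-y` the weak derivative
of `p`. -/
def laplacianGraph : Submodule ℝ (L2 × L2 × L2) :=
  testGraph.topologicalClosure.comap
      ((LinearMap.fst ℝ L2 (L2 × L2)).prod
        ((LinearMap.fst ℝ L2 L2).comp (LinearMap.snd ℝ L2 (L2 × L2)))) ⊓
    weakDerivGraph.comap
      (((LinearMap.fst ℝ L2 L2).comp (LinearMap.snd ℝ L2 (L2 × L2))).prod
        (-((LinearMap.snd ℝ L2 L2).comp (LinearMap.snd ℝ L2 (L2 × L2)))))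

theorem mem_laplacianGraph {u p y : L2} :
    (u, p, y) ∈ laplacianGraph ↔ HasWeakDerivH10 u p ∧ HasWeakDeriv p (-y) := by
  rw [hasWeakDerivH10_iff]
  rfl

/-- Closedness is what allows `A_H` to be applied term by term to the series of the semigroup. -/
theorem isClosed_laplacianGraph : IsClosed (laplacianGraph : Set (L2 × L2 × L2)) := by
  have h1 : IsClosed {q : L2 × L2 × L2 | (q.1, q.2.1) ∈ (testGraph.topologicalClosure : Set _)} :=
    (Submodule.isClosed_topologicalClosure testGraph).preimage (by fun_prop)
  have h2 : IsClosed {q : L2 × L2 × L2 | (q.2.1, -q.2.2) ∈ (weakDerivGraph : Set _)} :=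
    isClosed_weakDerivGraph.preimage (by fun_prop)
  exact h1.inter h2

theorem mem_dirichletLaplacian_iff {u y : L2} :
    y ∈ dirichletLaplacian u ↔ ∃ p, (u, p, y) ∈ laplacianGraph := by
  simp only [mem_laplacianGraph]; rfl

theorem dirichletLaplacian_sub {u u' y y' : L2} (h : y ∈ dirichletLaplacian u)
    (h' : y' ∈ dirichletLaplacian u') : y - y' ∈ dirichletLaplacian (u - u') := by
  rw [mem_dirichletLaplacian_iff] at *
  obtain ⟨p, hp⟩ := h
  obtain ⟨p', hp'⟩ := h'
  exact ⟨p - p', laplacianGraph.sub_mem hp hp'⟩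

theorem dirichletLaplacian_add {u u' y y' : L2} (h : y ∈ dirichletLaplacian u)
    (h' : y' ∈ dirichletLaplacian u') : y + y' ∈ dirichletLaplacian (u + u') := by
  rw [mem_dirichletLaplacian_iff] at *
  obtain ⟨p, hp⟩ := h
  obtain ⟨p', hp'⟩ := h'
  exact ⟨p + p', laplacianGraph.add_mem hp hp'⟩

theorem dirichletLaplacian_neg {u y : L2} (h : y ∈ dirichletLaplacian u) :
    -y ∈ dirichletLaplacian (-u) := by
  rw [mem_dirichletLaplacian_iff] at *
  obtain ⟨p, hp⟩ := h
  exact ⟨-p, laplacianGraph.neg_mem hp⟩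

/-- Green's formula for `u ∈ H¹₀` and `p` with weak derivative `-y`. -/
theorem HasWeakDerivH10.inner_eq {u u' p y : L2} (h : HasWeakDerivH10 u u')
    (hp : HasWeakDeriv p (-y)) : inner ℝ p u' = inner ℝ y u := by
  rw [hasWeakDerivH10_iff] at h
  have hc : IsClosed {q : L2 × L2 | inner ℝ p q.2 = inner ℝ y q.1} :=
    isClosed_eq (by fun_prop) (by fun_prop)
  -- The identity is a closed condition on the pair, and for test functions it is the definition of
  -- the weak derivative of `p`.
  refine closure_minimal ?_ hc h
  rintro _ ⟨φ, hφ, rfl⟩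
  have := hasWeakDeriv_iff.1 hp φ hφ
  rw [inner_neg_left] at this
  simp only [mem_ofPred_eq]
  linarith

/-- The Dirichlet Laplacian is symmetric. -/
theorem dirichletLaplacian_symm {u u' y y' : L2} (h : y ∈ dirichletLaplacian u)
    (h' : y' ∈ dirichletLaplacian u') : inner ℝ y u' = inner ℝ u y' := by
  obtain ⟨p, hp, hy⟩ := h
  obtain ⟨p', hp', hy'⟩ := h'
  -- Both sides equal the inner product of the first derivatives.
  rw [← hp'.inner_eq hy, real_inner_comm y' u, ← hp.inner_eq hy', real_inner_comm]

/-! ### Pointwise bounds for functions in `H¹₀` -/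

/-- Cauchy–Schwarz against the constant `1`, read off from the nonnegativity of the integral of `((b
- a) f - I)²`, with `I` the integral of `f`. -/
theorem sq_intervalIntegral_le {f : ℝ → ℝ} (hf : Continuous f) {a b : ℝ} (hab : a ≤ b) :
    (∫ x in a..b, f x) ^ 2 ≤ (b - a) * ∫ x in a..b, f x ^ 2 := by
  rcases hab.eq_or_lt with rfl | hlt
  · simp
  set I := ∫ x in a..b, f x
  have key : 0 ≤ ∫ x in a..b, ((b - a) * f x - I) ^ 2 :=
    intervalIntegral.integral_nonneg hab fun x _ => sq_nonneg _
  have e : ∫ x in a..b, ((b - a) * f x - I) ^ 2 =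
      (b - a) ^ 2 * (∫ x in a..b, f x ^ 2) - 2 * (b - a) * I * I + (b - a) * I ^ 2 := by
    have : ∀ x, ((b - a) * f x - I) ^ 2 =
        (b - a) ^ 2 * f x ^ 2 - 2 * (b - a) * I * f x + I ^ 2 := fun x => by ring
    simp_rw [this]
    rw [intervalIntegral.integral_add (Continuous.intervalIntegrable (by fun_prop) _ _)
      (by simp), intervalIntegral.integral_sub (Continuous.intervalIntegrable (by fun_prop) _ _)
      (Continuous.intervalIntegrable (by fun_prop) _ _),
      intervalIntegral.integral_const_mul, intervalIntegral.integral_const_mul,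
      intervalIntegral.integral_const, smul_eq_mul]
  rw [e] at key
  have hpos : 0 < b - a := sub_pos.2 hlt
  have : 0 ≤ (b - a) * ((b - a) * (∫ x in a..b, f x ^ 2) - I ^ 2) := by linarith
  linarith [nonneg_of_mul_nonneg_right this hpos]

theorem norm_sq_toL2 {f : ℝ → ℝ} (hf : Continuous f) :
    ‖toL2 f hf‖ ^ 2 = ∫ x in (0 : ℝ)..1, f x ^ 2 := by
  rw [← real_inner_self_eq_norm_sq, inner_toL2]
  simp [sq]

/-- Integrate the derivative from the nearer endpoint, where `φ` vanishes, and apply Cauchy–Schwarz.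
-/
theorem IsTest.sq_le {φ : ℝ → ℝ} (h : IsTest φ) {x : ℝ} (hx : x ∈ Ioo (0 : ℝ) 1) :
    φ x ^ 2 ≤ min x (1 - x) * ‖toL2 (deriv φ) h.continuous_deriv‖ ^ 2 := by
  have hc := h.continuous_deriv
  have hii : ∀ a b, IntervalIntegrable (fun x => deriv φ x ^ 2) volume a b := fun a b =>
    Continuous.intervalIntegrable (by fun_prop) _ _
  have hftc : ∀ a b, ∫ y in a..b, deriv φ y = φ b - φ a := fun a b =>
    intervalIntegral.integral_deriv_eq_sub (fun y _ => h.differentiable y)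
      (hc.intervalIntegrable _ _)
  have hsplit := intervalIntegral.integral_add_adjacent_intervals (hii 0 x) (hii x 1)
  have p1 : 0 ≤ ∫ y in (0 : ℝ)..x, deriv φ y ^ 2 :=
    intervalIntegral.integral_nonneg hx.1.le fun y _ => sq_nonneg _
  have p2 : 0 ≤ ∫ y in x..1, deriv φ y ^ 2 :=
    intervalIntegral.integral_nonneg hx.2.le fun y _ => sq_nonneg _
  have k1 := sq_intervalIntegral_le hc hx.1.le
  have k2 := sq_intervalIntegral_le hc hx.2.le
  rw [hftc, h.eq_zero (x := 0) (by simp)] at k1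
  rw [hftc, h.eq_zero (x := 1) (by simp)] at k2
  simp only [sub_zero, zero_sub, neg_sq] at k1 k2
  rw [norm_sq_toL2, ← hsplit]
  rcases min_cases x (1 - x) with ⟨e, -⟩ | ⟨e, -⟩ <;> rw [e]
  · nlinarith [mul_nonneg hx.1.le p2]
  · nlinarith [mul_nonneg (sub_nonneg.2 hx.2.le) p1]

/-- Elements of `H¹₀` vanish like a square root at the boundary. -/
theorem HasWeakDerivH10.sq_le {u p : L2} (h : HasWeakDerivH10 u p) :
    ∀ᵐ x ∂leb01, u x ^ 2 ≤ min x (1 - x) * ‖p‖ ^ 2 := by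
  rw [hasWeakDerivH10_iff, ← SetLike.mem_coe, Submodule.topologicalClosure_coe,
    mem_closure_iff_seq_limit] at h
  obtain ⟨q, hq, hlim⟩ := h
  choose φ hφ hqφ using hq
  have l1 : Tendsto (fun n => toL2 (φ n) (hφ n).1.continuous) atTop (𝓝 u) := by
    have := (continuous_fst.tendsto _).comp hlim
    refine this.congr fun n => ?_
    simp [hqφ n]
  have l2 : Tendsto (fun n => toL2 (deriv (φ n)) (hφ n).continuous_deriv) atTop (𝓝 p) := by
    have := (continuous_snd.tendsto _).comp hlim
    refine this.congr fun n => ?_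
    simp [hqφ n]
  -- Convergence in `L²` gives pointwise convergence only along a subsequence, which suffices for
  -- the limit of the bounds.
  obtain ⟨ns, hns, hae⟩ := (tendstoInMeasure_of_tendsto_Lp l1).exists_seq_tendsto_ae
  have hall : ∀ᵐ x ∂leb01, ∀ n, toL2 (φ n) (hφ n).1.continuous x = φ n x :=
    ae_all_iff.2 fun n => toL2_ae _ _
  filter_upwards [hae, hall, ae_restrict_mem measurableSet_Ioo] with x hx hx' hxI
  refine le_of_tendsto_of_tendsto (hx.pow 2)
    (((l2.comp hns.tendsto_atTop).norm.pow 2).const_mul (min x (1 - x))) ?_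
  refine Eventually.of_forall fun n => ?_
  simp only [hx', Function.comp]
  exact (hφ (ns n)).sq_le hxI

/-! ### Completeness of the sine basis -/

theorem integrable_mul_continuous (u : L2) {f : ℝ → ℝ} (hf : Continuous f) :
    Integrable (fun x => u x * f x) leb01 :=
  (Lp.memLp u).integrable_mul (memLp_of_continuous hf)

theorem dirichletCoeff_eq (k : ℕ) (u : L2) : dirichletCoeff k u =
    ∫ x, u x * (√2 * Real.sin ((k + 1 : ℝ) * Real.pi * x)) ∂leb01 := by
  rw [dirichletCoeff, real_inner_comm, dirichletEigenfunction, inner_toL2_right]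

/-- Each factor `cos(πx)` replaces frequency `k` by the average of `k - 1` and `k + 1`, so the
induction on the power runs over all frequencies at once; frequency `0` is harmless because the sine
vanishes. -/
theorem integral_sin_mul_cos_pow_eq_zero {u : L2} (h : ∀ k, dirichletCoeff k u = 0) (n k : ℕ) :
    ∫ x, u x * (Real.sin (k * Real.pi * x) * Real.cos (Real.pi * x) ^ n) ∂leb01 = 0 := by
  induction n generalizing k with
  | zero =>
    cases k with
    | zero => simp
    | succ k =>
      have hk := h k
      rw [dirichletCoeff_eq] at hk
      have e : ∀ x, u x * (√2 * Real.sin ((k + 1 : ℝ) * Real.pi * x)) =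
          √2 * (u x * (Real.sin (((k + 1 : ℕ) : ℝ) * Real.pi * x) *
            Real.cos (Real.pi * x) ^ 0)) := fun x => by push_cast; ring
      simp_rw [e] at hk
      rw [integral_const_mul] at hk
      exact (mul_eq_zero.1 hk).resolve_left (by positivity)
  | succ n ih =>
    cases k with
    | zero => simp
    | succ k =>
      have e : ∀ x, u x * (Real.sin (((k + 1 : ℕ) : ℝ) * Real.pi * x) *
          Real.cos (Real.pi * x) ^ (n + 1)) =
          2⁻¹ * (u x * (Real.sin (((k + 2 : ℕ) : ℝ) * Real.pi * x) *
            Real.cos (Real.pi * x) ^ n)) +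
          2⁻¹ * (u x * (Real.sin ((k : ℝ) * Real.pi * x) * Real.cos (Real.pi * x) ^ n)) := by
        intro x
        have e1 : ((k + 2 : ℕ) : ℝ) * Real.pi * x =
          ((k + 1 : ℕ) : ℝ) * Real.pi * x + Real.pi * x := by push_cast; ring
        have e2 : (k : ℝ) * Real.pi * x =
          ((k + 1 : ℕ) : ℝ) * Real.pi * x - Real.pi * x := by push_cast; ring
        rw [e1, e2, Real.sin_add, Real.sin_sub]
        ring
      simp_rw [e]
      rw [integral_add ((integrable_mul_continuous u (by fun_prop)).const_mul _)
        ((integrable_mul_continuous u (by fun_prop)).const_mul _), integral_const_mul,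
        integral_const_mul, ih, ih]
      simp

theorem integral_sin_mul_polynomial_cos_eq_zero {u : L2} (h : ∀ k, dirichletCoeff k u = 0)
    (p : Polynomial ℝ) :
    ∫ x, u x * Real.sin (Real.pi * x) * p.eval (Real.cos (Real.pi * x)) ∂leb01 = 0 := by
  induction p using Polynomial.induction_on' with
  | add p q hp hq =>
    simp only [Polynomial.eval_add, mul_add]
    rw [integral_add, hp, hq, add_zero]
    all_goals
      simp only [mul_assoc]
      exact integrable_mul_continuous u (by fun_prop)
  | monomial n a =>
    have e : ∀ x, u x * Real.sin (Real.pi * x) *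
        (Polynomial.monomial n a).eval (Real.cos (Real.pi * x)) =
        a * (u x * (Real.sin (((1 : ℕ) : ℝ) * Real.pi * x) * Real.cos (Real.pi * x) ^ n)) := by
      intro x
      rw [Polynomial.eval_monomial, Nat.cast_one, one_mul]
      ring
    simp_rw [e]
    rw [integral_const_mul, integral_sin_mul_cos_pow_eq_zero h, mul_zero]

/-- On `[0,1]` the map `cos(πx)` is invertible, so `φ` is a continuous function of it and
Weierstrass approximation reduces the claim to polynomials. -/
theorem integral_sin_mul_eq_zero {u : L2} (h : ∀ k, dirichletCoeff k u = 0) {φ : ℝ → ℝ}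
    (hφ : Continuous φ) : ∫ x, u x * Real.sin (Real.pi * x) * φ x ∂leb01 = 0 := by
  have hi : Integrable (fun x => u x * Real.sin (Real.pi * x)) leb01 :=
    integrable_mul_continuous u (by fun_prop)
  set N := ∫ x, ‖u x * Real.sin (Real.pi * x)‖ ∂leb01 with hN
  have hN0 : 0 ≤ N := integral_nonneg fun x => norm_nonneg _
  rw [← norm_eq_zero]
  refine le_antisymm (le_of_forall_pos_le_add fun ε hε => ?_) (norm_nonneg _)
  obtain ⟨p, hp⟩ := exists_polynomial_near_of_continuousOn (-1) 1
    (fun s => φ (Real.arccos s / Real.pi)) (by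
      -- The tolerance has `N + 1` below because `N` may be zero.
      have := Real.continuous_arccos
      exact Continuous.continuousOn (by fun_prop)) (ε / (N + 1)) (by positivity)
  have hi1 : Integrable (fun x => u x * Real.sin (Real.pi * x) * φ x) leb01 := by
    simp only [mul_assoc]
    exact integrable_mul_continuous u (by fun_prop)
  have hi2 : Integrable (fun x => u x * Real.sin (Real.pi * x) *
      p.eval (Real.cos (Real.pi * x))) leb01 := by
    simp only [mul_assoc]
    exact integrable_mul_continuous u (by fun_prop)
  have e : ∫ x, u x * Real.sin (Real.pi * x) * φ x ∂leb01 =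
      ∫ x, (u x * Real.sin (Real.pi * x) * φ x -
        u x * Real.sin (Real.pi * x) * p.eval (Real.cos (Real.pi * x))) ∂leb01 := by
    rw [integral_sub hi1 hi2, integral_sin_mul_polynomial_cos_eq_zero h, sub_zero]
  rw [e, zero_add]
  calc _ ≤ ∫ x, ‖u x * Real.sin (Real.pi * x)‖ * (ε / (N + 1)) ∂leb01 := by
        refine norm_integral_le_of_norm_le (hi.norm.mul_const _) ?_
        filter_upwards [ae_restrict_mem measurableSet_Ioo] with x hx
        rw [← mul_sub, norm_mul]
        refine mul_le_mul_of_nonneg_left ?_ (norm_nonneg _)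
        have hpx := hp (Real.cos (Real.pi * x)) ⟨Real.neg_one_le_cos _, Real.cos_le_one _⟩
        rw [Real.arccos_cos (mul_nonneg Real.pi_pos.le hx.1.le)
          (mul_le_of_le_one_right Real.pi_pos.le hx.2.le),
          mul_div_cancel_left₀ _ Real.pi_ne_zero, abs_sub_comm] at hpx
        exact hpx.le
    _ = N * (ε / (N + 1)) := by rw [integral_mul_const]
    _ = N / (N + 1) * ε := by ring
    _ ≤ 1 * ε := by
        gcongr
        rw [div_le_one (by positivity)]
        linarith
    _ = ε := one_mul _

/-- The product `u sin(πx)` is orthogonal to all test functions, hence zero, and the sine is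
positive inside the interval. -/
theorem eq_zero_of_dirichletCoeff_eq_zero {u : L2} (h : ∀ k, dirichletCoeff k u = 0) :
    u = 0 := by
  have hi : Integrable (fun x => u x * Real.sin (Real.pi * x)) leb01 :=
    integrable_mul_continuous u (by fun_prop)
  have key := isOpen_Ioo.ae_eq_zero_of_integral_contDiff_smul_eq_zero (μ := volume)
    (U := Ioo (0 : ℝ) 1) (f := fun x => u x * Real.sin (Real.pi * x))
    (IntegrableOn.locallyIntegrableOn hi) (fun g hg _ hsupp => by
      rw [← integral_sin_mul_eq_zero h hg.continuous]
      rw [← setIntegral_eq_integral_of_forall_compl_eq_zero (s := Ioo (0 : ℝ) 1)]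
      · simp only [smul_eq_mul, mul_comm]
      · intro x hx
        have : g x = 0 := by
          by_contra hne
          exact hx (hsupp (subset_tsupport _ hne))
        simp [this])
  rw [← ae_restrict_iff' measurableSet_Ioo] at key
  apply Lp.ext
  filter_upwards [key, ae_restrict_mem measurableSet_Ioo, Lp.coeFn_zero ℝ 2 leb01]
    with x hx hxI h0
  rw [h0]
  refine (mul_eq_zero.1 hx).resolve_right (Real.sin_pos_of_pos_of_lt_pi ?_ ?_).ne'
  · exact mul_pos Real.pi_pos hxI.1
  · exact mul_lt_of_lt_one_right Real.pi_pos hxI.2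

/-- The eigenfunctions of the Dirichlet Laplacian as a Hilbert basis of `L²(0,1)`. -/
def dirichletBasis : HilbertBasis ℕ ℝ L2 :=
  HilbertBasis.mkOfOrthogonalEqBot orthonormal_dirichletEigenfunction (by
    rw [Submodule.eq_bot_iff]
    intro u hu
    refine eq_zero_of_dirichletCoeff_eq_zero fun k => ?_
    exact (Submodule.mem_orthogonal _ _).1 hu _ (Submodule.subset_span (mem_range_self k)))

theorem coe_dirichletBasis : ⇑dirichletBasis = dirichletEigenfunction :=
  HilbertBasis.coe_mkOfOrthogonalEqBot _ _

theorem hasSum_dirichletCoeff (u : L2) :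
    HasSum (fun k => dirichletCoeff k u • dirichletEigenfunction k) u := by
  have h := dirichletBasis.hasSum_repr u
  simp only [dirichletBasis.repr_apply_apply, coe_dirichletBasis] at h
  exact h

theorem hasSum_dirichletCoeff_sq (u : L2) :
    HasSum (fun k => dirichletCoeff k u ^ 2) (‖u‖ ^ 2) := by
  have := dirichletBasis.hasSum_inner_mul_inner u u
  rw [real_inner_self_eq_norm_sq, coe_dirichletBasis] at this
  refine this.congr_fun fun k => ?_
  rw [real_inner_comm, dirichletCoeff, sq]

theorem dirichletCoeff_of_hasSum {a : ℕ → ℝ} {u : L2}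
    (h : HasSum (fun k => a k • dirichletEigenfunction k) u) (j : ℕ) :
    dirichletCoeff j u = a j := by
  have h1 := h.mapL (innerSL ℝ (dirichletEigenfunction j))
  have h2 : HasSum (fun k => innerSL ℝ (dirichletEigenfunction j)
      (a k • dirichletEigenfunction k)) (a j) := by
    have : (fun k => innerSL ℝ (dirichletEigenfunction j) (a k • dirichletEigenfunction k)) =
        fun k => if k = j then a j else 0 := by
      ext k
      rw [innerSL_apply_apply, real_inner_smul_right,
        orthonormal_iff_ite.1 orthonormal_dirichletEigenfunction]
      by_cases hk : k = j
      · simp [hk]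
      · simp [hk, Ne.symm hk]
    rw [this]
    exact hasSum_ite_eq j (a j)
  exact h1.unique h2

theorem summable_smul_dirichletEigenfunction_iff {a : ℕ → ℝ} :
    Summable (fun k => a k • dirichletEigenfunction k) ↔ Summable (fun k => a k ^ 2) := by
  have := orthonormal_dirichletEigenfunction.orthogonalFamily.summable_iff_norm_sq_summable a
  simpa using this

/-! ### Estimates in `V_H^{2r}` -/

theorem dirichletEigenvalue_pos (k : ℕ) : 0 < dirichletEigenvalue k := by
  have := Real.pi_pos
  unfold dirichletEigenvalue
  positivity

theorem mem_VH_iff {r : ℝ} {u : L2} :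
    u ∈ VH r ↔ Summable fun k => (dirichletEigenvalue k ^ r * dirichletCoeff k u) ^ 2 :=
  summable_smul_dirichletEigenfunction_iff

theorem normVH_nonneg (r : ℝ) (z : VH r) : 0 ≤ normVH r z := norm_nonneg _

theorem hasSum_normVH_sq {r : ℝ} (z : VH r) :
    HasSum (fun k => (dirichletEigenvalue k ^ r * dirichletCoeff k (z : L2)) ^ 2)
      (normVH r z ^ 2) := by
  have h : HasSum (fun k => (dirichletEigenvalue k ^ r * dirichletCoeff k (z : L2)) •
      dirichletEigenfunction k) (dirichletPow r z) := Summable.hasSum z.2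
  refine (hasSum_dirichletCoeff_sq (dirichletPow r z)).congr_fun fun k => ?_
  rw [dirichletCoeff_of_hasSum h]

theorem normVH_neg {r : ℝ} (z : VH r) : normVH r (-z) = normVH r z := by
  rw [← sq_eq_sq₀ (normVH_nonneg _ _) (normVH_nonneg _ _)]
  refine (hasSum_normVH_sq (-z)).unique ?_
  refine (hasSum_normVH_sq z).congr_fun fun k => ?_
  simp [dirichletCoeff]

/-- The terms are a constant times `(k+1)^(2 - 4r)`; this is where the threshold `3/4` enters. -/
theorem summable_sq_mul_dirichletEigenvalue_rpow {r : ℝ} (hr : 3 / 4 < r) :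
    Summable fun k : ℕ => ((k + 1 : ℝ) * dirichletEigenvalue k ^ (-r)) ^ 2 := by
  have hp := Real.pi_pos
  have h1 : Summable fun k : ℕ => ((k + 1 : ℕ) : ℝ) ^ (2 - 4 * r) :=
    (summable_nat_add_iff 1).2 (Real.summable_nat_rpow.2 (by linarith))
  refine (h1.mul_left (Real.pi ^ (-(4 * r)))).congr fun k => ?_
  have hk : (0 : ℝ) < k + 1 := by positivity
  have e : dirichletEigenvalue k ^ (-r) = ((k + 1 : ℝ) * Real.pi) ^ (2 * -r) := by
    rw [dirichletEigenvalue, Real.rpow_mul (by positivity), Real.rpow_two]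
  rw [e, mul_pow, ← Real.rpow_two, ← Real.rpow_two, ← Real.rpow_mul (by positivity),
    Real.mul_rpow (by positivity) (by positivity)]
  push_cast
  rw [show (2 - 4 * r : ℝ) = 2 + 2 * -r * 2 by ring, Real.rpow_add hk,
    show -(4 * r) = 2 * -r * 2 by ring]
  ring

/-- Induction by the addition formula. Only one factor of the frequency is lost, which fixes the
weight `k + 1` used below. -/
theorem abs_sin_nat_mul_le (n : ℕ) (θ : ℝ) : |Real.sin (n * θ)| ≤ n * |Real.sin θ| := by
  induction n with
  | zero => simp
  | succ n ih =>
    push_cast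
    rw [add_mul, one_mul, Real.sin_add]
    refine (abs_add_le _ _).trans ?_
    rw [abs_mul, abs_mul, add_mul, one_mul]
    have h1 : |Real.sin (n * θ)| * |Real.cos θ| ≤ |Real.sin (n * θ)| :=
      mul_le_of_le_one_right (abs_nonneg _) (Real.abs_cos_le_one _)
    have h2 : |Real.cos (n * θ)| * |Real.sin θ| ≤ |Real.sin θ| :=
      mul_le_of_le_one_left (abs_nonneg _) (Real.abs_cos_le_one _)
    linarith

/-- Use `sin s ≤ s` at the nearer endpoint; the distance to the other one is at least `1/2`, whence
the factor `2`. -/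
theorem sin_pi_mul_le {x : ℝ} (hx : x ∈ Ioo (0 : ℝ) 1) :
    Real.sin (Real.pi * x) ≤ 2 * Real.pi * (x * (1 - x)) := by
  have hp := Real.pi_pos
  have h1 : Real.sin (Real.pi * x) ≤ Real.pi * x := Real.sin_le (by have := hx.1; positivity)
  have h2 : Real.sin (Real.pi * x) ≤ Real.pi * (1 - x) := by
    rw [← Real.sin_pi_sub]
    refine (Real.sin_le ?_).trans_eq (by ring)
    nlinarith [hx.2]
  rcases le_total x (1 / 2) with h | h
  · have : Real.pi * x * 1 ≤ Real.pi * x * (2 * (1 - x)) := by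
      have := hx.1
      gcongr
      linarith
    linarith
  · have : Real.pi * (1 - x) * 1 ≤ Real.pi * (1 - x) * (2 * x) := by
      have := sub_pos.2 hx.2
      gcongr
      linarith
    linarith

/-- The first eigenfunction dominates the others. -/
theorem smul_dirichletEigenfunction_le (c : ℝ) (k : ℕ) :
    c • dirichletEigenfunction k ≤ ((k + 1 : ℝ) * |c|) • dirichletEigenfunction 0 := by
  rw [← Lp.coeFn_le]
  filter_upwards [Lp.coeFn_smul c (dirichletEigenfunction k),
    Lp.coeFn_smul ((k + 1 : ℝ) * |c|) (dirichletEigenfunction 0),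
    toL2_ae (fun x => √2 * Real.sin ((k + 1 : ℝ) * Real.pi * x)) (by fun_prop),
    toL2_ae (fun x => √2 * Real.sin (((0 : ℕ) + 1 : ℝ) * Real.pi * x)) (by fun_prop),
    ae_restrict_mem measurableSet_Ioo] with x h1 h2 h3 h4 hx
  rw [h1, h2, Pi.smul_apply, Pi.smul_apply, dirichletEigenfunction, dirichletEigenfunction,
    h3, h4, smul_eq_mul, smul_eq_mul]
  have hs : 0 ≤ Real.sin (Real.pi * x) := Real.sin_nonneg_of_nonneg_of_le_pi
    (mul_nonneg Real.pi_pos.le hx.1.le) (mul_le_of_le_one_right Real.pi_pos.le hx.2.le)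
  have hk := abs_sin_nat_mul_le (k + 1) (Real.pi * x)
  rw [abs_of_nonneg hs] at hk
  push_cast at hk
  rw [← mul_assoc] at hk
  calc c * (√2 * Real.sin ((k + 1 : ℝ) * Real.pi * x))
      ≤ |c * (√2 * Real.sin ((k + 1 : ℝ) * Real.pi * x))| := le_abs_self _
    _ = |c| * √2 * |Real.sin ((k + 1 : ℝ) * Real.pi * x)| := by
      rw [abs_mul, abs_mul, abs_of_nonneg (Real.sqrt_nonneg 2)]
      ring
    _ ≤ |c| * √2 * ((k + 1) * Real.sin (Real.pi * x)) := by gcongr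
    _ = _ := by simp only [Nat.cast_zero, zero_add, one_mul]; ring

/-- Pointwise bounds from weighted summability of the coefficients. -/
theorem ae_abs_le_of_summable {z : L2}
    (h : Summable fun k : ℕ => (k + 1 : ℝ) * |dirichletCoeff k z|) :
    ∀ᵐ x ∂leb01, |z x| ≤ (√2 * (2 * Real.pi)) *
      (∑' k : ℕ, (k + 1 : ℝ) * |dirichletCoeff k z|) * (x * (1 - x)) := by
  set T := ∑' k : ℕ, (k + 1 : ℝ) * |dirichletCoeff k z|
  have hT : 0 ≤ T := tsum_nonneg fun k => by positivity
  have hsum := h.hasSum.smul_const (dirichletEigenfunction 0)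
  have hz := hasSum_dirichletCoeff z
  -- The order of `L²` is closed, so termwise domination passes to the sums and no pointwise
  -- convergence of the Fourier series is needed.
  have u1 : z ≤ T • dirichletEigenfunction 0 :=
    hasSum_le (fun k => smul_dirichletEigenfunction_le _ _) hz hsum
  have u2 : -z ≤ T • dirichletEigenfunction 0 := by
    refine hasSum_le (fun k => ?_) hz.neg hsum
    rw [← neg_smul, ← abs_neg (dirichletCoeff k z)]
    exact smul_dirichletEigenfunction_le _ _
  rw [← Lp.coeFn_le] at u1 u2
  filter_upwards [u1, u2, Lp.coeFn_neg z, Lp.coeFn_smul T (dirichletEigenfunction 0),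
    toL2_ae (fun x => √2 * Real.sin (((0 : ℕ) + 1 : ℝ) * Real.pi * x)) (by fun_prop),
    ae_restrict_mem measurableSet_Ioo] with x h1 h2 h3 h4 h5 hx
  rw [h3, Pi.neg_apply] at h2
  rw [h4, Pi.smul_apply, dirichletEigenfunction, h5, smul_eq_mul] at h1 h2
  refine (abs_le'.2 ⟨h1, h2⟩).trans ?_
  have := sin_pi_mul_le hx
  simp only [Nat.cast_zero, zero_add, one_mul]
  calc T * (√2 * Real.sin (Real.pi * x)) ≤ T * (√2 * (2 * Real.pi * (x * (1 - x)))) := by gcongr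
    _ = _ := by ring

/-- Cauchy–Schwarz in Young's form: `ab ≤ L a² + L⁻¹ b²`, with `a` the summable weight and `b` the
`V_H^{2r}` coefficient. Summing gives `L A + L⁻¹ ‖z‖² ≤ (A + 1) L`. A free `L > 0` above the norm
avoids dividing by the norm when `z = 0`. -/
theorem exists_tsum_le_normVH {r : ℝ} (hr : 3 / 4 < r) :
    ∃ K : ℝ, 0 < K ∧ ∀ z : VH r,
      Summable (fun k : ℕ => (k + 1 : ℝ) * |dirichletCoeff k (z : L2)|) ∧
      ∀ L : ℝ, 0 < L → normVH r z ≤ L →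
        ∑' k : ℕ, (k + 1 : ℝ) * |dirichletCoeff k (z : L2)| ≤ K * L := by
  have hs := summable_sq_mul_dirichletEigenvalue_rpow hr
  set A := ∑' k : ℕ, ((k + 1 : ℝ) * dirichletEigenvalue k ^ (-r)) ^ 2 with hA
  have hA0 : 0 ≤ A := tsum_nonneg fun k => sq_nonneg _
  have hterm : ∀ (z : VH r) (L : ℝ), 0 < L → ∀ k : ℕ,
      (k + 1 : ℝ) * |dirichletCoeff k (z : L2)| ≤
        L * ((k + 1 : ℝ) * dirichletEigenvalue k ^ (-r)) ^ 2 +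
        L⁻¹ * (dirichletEigenvalue k ^ r * dirichletCoeff k (z : L2)) ^ 2 := by
    intro z L hL k
    have hμ := dirichletEigenvalue_pos k
    set a := (k + 1 : ℝ) * dirichletEigenvalue k ^ (-r) with ha
    set b := dirichletEigenvalue k ^ r * |dirichletCoeff k (z : L2)| with hb
    have e : (k + 1 : ℝ) * |dirichletCoeff k (z : L2)| = a * b := by
      rw [ha, hb, mul_mul_mul_comm]
      have : dirichletEigenvalue k ^ (-r) * (dirichletEigenvalue k ^ r) = 1 := by
        rw [← Real.rpow_add hμ]; simp
      linear_combination (-(k + 1 : ℝ) * |dirichletCoeff k (z : L2)|) * this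
    have e2 : (dirichletEigenvalue k ^ r * dirichletCoeff k (z : L2)) ^ 2 = b ^ 2 := by
      rw [hb, mul_pow, mul_pow, sq_abs]
    rw [e, e2]
    have h0 : 0 ≤ L⁻¹ * (L * a - b) ^ 2 := by positivity
    have h1 : L⁻¹ * (L * a - b) ^ 2 = L * a ^ 2 - 2 * (a * b) + L⁻¹ * b ^ 2 := by
      field_simp
      ring
    have h2 : 0 ≤ L * a ^ 2 + L⁻¹ * b ^ 2 := by positivity
    linarith
  have hbs : ∀ (z : VH r) (L : ℝ), Summable fun k : ℕ =>
      L * ((k + 1 : ℝ) * dirichletEigenvalue k ^ (-r)) ^ 2 +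
        L⁻¹ * (dirichletEigenvalue k ^ r * dirichletCoeff k (z : L2)) ^ 2 := fun z L =>
    (hs.mul_left L).add ((hasSum_normVH_sq z).summable.mul_left L⁻¹)
  refine ⟨A + 1, by positivity, fun z => ?_⟩
  have hsum : Summable (fun k : ℕ => (k + 1 : ℝ) * |dirichletCoeff k (z : L2)|) :=
    (hbs z 1).of_nonneg_of_le (fun k => by positivity) (hterm z 1 one_pos)
  refine ⟨hsum, fun L hL hzL => ?_⟩
  refine (hsum.tsum_le_tsum (hterm z L hL) (hbs z L)).trans ?_
  rw [(hs.mul_left L).tsum_add ((hasSum_normVH_sq z).summable.mul_left L⁻¹), tsum_mul_left,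
    tsum_mul_left, (hasSum_normVH_sq z).tsum_eq, ← hA]
  have h2 : normVH r z ^ 2 ≤ L ^ 2 := pow_le_pow_left₀ (normVH_nonneg _ _) hzL 2
  calc L * A + L⁻¹ * normVH r z ^ 2 ≤ L * A + L⁻¹ * L ^ 2 := by gcongr
    _ = (A + 1) * L := by field_simp

/-- `V_H^{2r}` embeds into the functions bounded by a multiple of `x (1 - x)`. -/
theorem exists_ae_abs_le_normVH {r : ℝ} (hr : 3 / 4 < r) :
    ∃ K : ℝ, 0 < K ∧ ∀ (z : VH r) (L : ℝ), 0 < L → normVH r z ≤ L →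
      ∀ᵐ x ∂leb01, |(z : L2) x| ≤ K * L * (x * (1 - x)) := by
  obtain ⟨K, hK, h⟩ := exists_tsum_le_normVH hr
  have hp := Real.pi_pos
  refine ⟨√2 * (2 * Real.pi) * K, by positivity, fun z L hL hz => ?_⟩
  filter_upwards [ae_abs_le_of_summable (h z).1, ae_restrict_mem measurableSet_Ioo] with x hx hxI
  refine hx.trans ?_
  have := mul_pos hxI.1 (sub_pos.2 hxI.2)
  rw [mul_assoc _ K L]
  gcongr
  exact (h z).2 L hL hz

/-! ### The heat semigroup -/

theorem one_le_dirichletEigenvalue (k : ℕ) : 1 ≤ dirichletEigenvalue k := by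
  have hp := Real.pi_gt_three
  have hk : (0 : ℝ) ≤ k := Nat.cast_nonneg k
  unfold dirichletEigenvalue
  refine one_le_pow₀ ?_
  nlinarith

theorem dirichletEigenvalue_zero_le (k : ℕ) : dirichletEigenvalue 0 ≤ dirichletEigenvalue k := by
  have hp := Real.pi_pos
  unfold dirichletEigenvalue
  gcongr
  simp

theorem summable_inv_dirichletEigenvalue : Summable fun k => (dirichletEigenvalue k)⁻¹ := by
  have h1 : Summable fun k : ℕ => (((k + 1 : ℕ) : ℝ) ^ 2)⁻¹ :=
    (summable_nat_add_iff 1).2 (Real.summable_nat_pow_inv.2 one_lt_two)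
  refine (h1.mul_left (Real.pi ^ 2)⁻¹).congr fun k => ?_
  rw [dirichletEigenvalue, mul_pow, mul_inv]
  push_cast
  ring

/-- Parabolic smoothing: `e^s ≥ s²/2` bounds the multiplier of `A_H e^{-A_H T}` by a multiple of
`μ⁻¹`, which is summable over the spectrum. The series therefore converges absolutely for every `z`
in `L²`. -/
theorem mul_exp_neg_le {μ T : ℝ} (hμ : 0 < μ) (hT : 0 < T) :
    μ * Real.exp (-μ * T) ≤ 2 / T ^ 2 * μ⁻¹ := by
  have h := Real.quadratic_le_exp_of_nonneg (mul_pos hμ hT).le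
  have h' : (μ * T) ^ 2 / 2 ≤ Real.exp (μ * T) := by
    have := mul_pos hμ hT
    linarith
  rw [neg_mul, Real.exp_neg]
  calc μ * (Real.exp (μ * T))⁻¹ ≤ μ * ((μ * T) ^ 2 / 2)⁻¹ := by gcongr
    _ = _ := by field_simp

theorem abs_dirichletCoeff_le (k : ℕ) (z : L2) : |dirichletCoeff k z| ≤ ‖z‖ := by
  have := abs_real_inner_le_norm (dirichletEigenfunction k) z
  rwa [orthonormal_dirichletEigenfunction.1 k, one_mul] at this

theorem norm_smul_dirichletEigenfunction (c : ℝ) (k : ℕ) :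
    ‖c • dirichletEigenfunction k‖ = |c| := by
  rw [norm_smul, orthonormal_dirichletEigenfunction.1 k, mul_one, Real.norm_eq_abs]

theorem dirichletCoeff_heatSemigroup {t : ℝ} (ht : 0 ≤ t) (z : L2) (k : ℕ) :
    dirichletCoeff k (heatSemigroup t z) =
      Real.exp (-dirichletEigenvalue k * t) * dirichletCoeff k z :=
  dirichletCoeff_of_hasSum (heatSemigroup_hasSum t ht z) k

theorem heatSemigroup_zero_time (z : L2) : heatSemigroup 0 z = z := by
  have h := heatSemigroup_hasSum 0 le_rfl z
  simp only [mul_zero, Real.exp_zero, one_mul] at h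
  exact h.unique (hasSum_dirichletCoeff z)

theorem heatSemigroup_zero (t : ℝ) : heatSemigroup t 0 = 0 := by
  simp [heatSemigroup, dirichletCoeff]

theorem heatSemigroup_neg (t : ℝ) (z : L2) : heatSemigroup t (-z) = -heatSemigroup t z := by
  simp only [heatSemigroup, dirichletCoeff, inner_neg_right, mul_neg, neg_smul, tsum_neg]

/-- Every mode decays at least as fast as the lowest one, which has index `0` here and eigenvalue
`π²`. -/
theorem sq_heatSemigroup_coeff_le {t : ℝ} (ht : 0 ≤ t) (r : ℝ) (z : L2) (k : ℕ) :
    (dirichletEigenvalue k ^ r * dirichletCoeff k (heatSemigroup t z)) ^ 2 ≤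
      Real.exp (-dirichletEigenvalue 0 * t) ^ 2 *
        (dirichletEigenvalue k ^ r * dirichletCoeff k z) ^ 2 := by
  have hk := dirichletEigenvalue_zero_le k
  rw [dirichletCoeff_heatSemigroup ht, mul_left_comm, mul_pow]
  gcongr

theorem heatSemigroup_mem_VH {t r : ℝ} (ht : 0 ≤ t) {z : L2} (hz : z ∈ VH r) :
    heatSemigroup t z ∈ VH r := by
  rw [mem_VH_iff] at hz ⊢
  exact (hz.mul_left _).of_nonneg_of_le (fun k => sq_nonneg _)
    (sq_heatSemigroup_coeff_le ht r z)

theorem normVH_heatSemigroup_le {t r : ℝ} (ht : 0 ≤ t) (z : VH r) :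
    normVH r ⟨heatSemigroup t z, heatSemigroup_mem_VH ht z.2⟩ ≤
      Real.exp (-dirichletEigenvalue 0 * t) * normVH r z := by
  have h1 := hasSum_normVH_sq (⟨heatSemigroup t z, heatSemigroup_mem_VH ht z.2⟩ : VH r)
  have h2 := (hasSum_normVH_sq z).mul_left (Real.exp (-dirichletEigenvalue 0 * t) ^ 2)
  have h := hasSum_le (sq_heatSemigroup_coeff_le ht r z) h1 h2
  rw [← mul_pow] at h
  exact le_of_sq_le_sq h (mul_nonneg (Real.exp_pos _).le (normVH_nonneg _ _))

/-- Summable coefficients make the series uniformly convergent up to `t = 0`; data in `V_H^{2r}`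
with `r > 3/4` have them. -/
theorem continuousOn_heatSemigroup {z : L2} (h : Summable fun k => |dirichletCoeff k z|) :
    ContinuousOn (fun t => heatSemigroup t z) (Ici 0) := by
  unfold heatSemigroup
  refine continuousOn_tsum (fun k => Continuous.continuousOn (by fun_prop)) h ?_
  intro k t ht
  rw [norm_smul_dirichletEigenfunction, abs_mul, abs_of_pos (Real.exp_pos _)]
  refine mul_le_of_le_one_left (abs_nonneg _) (Real.exp_le_one_iff.2 ?_)
  have := mul_nonneg (dirichletEigenvalue_pos k).le ht
  linarith

/-- `A_H e^{-A_H t} z`. -/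
def heatSemigroupLaplacian (t : ℝ) (z : L2) : L2 :=
  ∑' k : ℕ, (dirichletEigenvalue k * Real.exp (-dirichletEigenvalue k * t) *
    dirichletCoeff k z) • dirichletEigenfunction k

theorem abs_heatSemigroupLaplacian_coeff_le {T t : ℝ} (hT : 0 < T) (ht : T ≤ t) (z : L2)
    (k : ℕ) : |dirichletEigenvalue k * Real.exp (-dirichletEigenvalue k * t) *
      dirichletCoeff k z| ≤ 2 / T ^ 2 * (dirichletEigenvalue k)⁻¹ * ‖z‖ := by
  have hμ := dirichletEigenvalue_pos k
  rw [abs_mul, abs_of_pos (by positivity)]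
  refine mul_le_mul ?_ (abs_dirichletCoeff_le k z) (abs_nonneg _) (by positivity)
  refine le_trans ?_ (mul_exp_neg_le hμ hT)
  have := mul_le_mul_of_nonneg_left ht hμ.le
  gcongr 2
  linarith

theorem summable_heatSemigroupLaplacian_bound (T : ℝ) (z : L2) :
    Summable fun k => 2 / T ^ 2 * (dirichletEigenvalue k)⁻¹ * ‖z‖ :=
  (summable_inv_dirichletEigenvalue.mul_left _).mul_right _

theorem hasDerivAt_heatSemigroup {t : ℝ} (ht : 0 < t) (z : L2) :
    HasDerivAt (fun t => heatSemigroup t z) (-heatSemigroupLaplacian t z) t := by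
  rw [heatSemigroupLaplacian, ← tsum_neg]
  -- The derivative bound blows up at time `0`, so the series is differentiated on `(t/2, ∞)`, where
  -- it is uniform.
  refine hasDerivAt_tsum_of_isPreconnected
    (g := fun k s => (Real.exp (-dirichletEigenvalue k * s) * dirichletCoeff k z) •
      dirichletEigenfunction k)
    (g' := fun k s => -((dirichletEigenvalue k * Real.exp (-dirichletEigenvalue k * s) *
      dirichletCoeff k z) • dirichletEigenfunction k))
    (summable_heatSemigroupLaplacian_bound (t / 2) z)
    (isOpen_Ioi (a := t / 2)) isPreconnected_Ioi ?_ ?_ (y₀ := t) (by simp [ht])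
    (heatSemigroup_hasSum t ht.le z).summable (by simp [ht])
  · intro k s _
    have h1 : HasDerivAt (fun s => -dirichletEigenvalue k * s) (-dirichletEigenvalue k) s := by
      simpa using (hasDerivAt_id s).const_mul (-dirichletEigenvalue k)
    rw [← neg_smul]
    convert! ((h1.exp.mul_const (dirichletCoeff k z)).smul_const (dirichletEigenfunction k))
      using 2
    ring
  · intro k s hs
    rw [norm_neg, norm_smul_dirichletEigenfunction]
    exact abs_heatSemigroupLaplacian_coeff_le (half_pos ht) (le_of_lt hs) z k

theorem norm_heatSemigroupLaplacian_le {T t : ℝ} (hT : 0 < T) (ht : T ≤ t) (z : L2) :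
    ‖heatSemigroupLaplacian t z‖ ≤ ∑' k, 2 / T ^ 2 * (dirichletEigenvalue k)⁻¹ * ‖z‖ := by
  refine tsum_of_norm_bounded (summable_heatSemigroupLaplacian_bound T z).hasSum fun k => ?_
  rw [norm_smul_dirichletEigenfunction]
  exact abs_heatSemigroupLaplacian_coeff_le hT ht z k

theorem heatSemigroupLaplacian_mem {t : ℝ} (ht : 0 < t) (z : L2) :
    heatSemigroupLaplacian t z ∈ dirichletLaplacian (heatSemigroup t z) := by
  have hp : ∀ k, ∃ p, (dirichletEigenfunction k, p,
      dirichletEigenvalue k • dirichletEigenfunction k) ∈ laplacianGraph := fun k =>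
    mem_dirichletLaplacian_iff.1 (dirichletEigenfunction_mem k)
  choose p hp using hp
  -- Green's formula gives `‖p k‖² = μₖ`. Since `μₖ ≥ 1`, the cruder bound `μₖ` holds, and the
  -- series of first derivatives shares the majorant of `A_H e^{-A_H t} z`.
  have hnp : ∀ k, ‖p k‖ ≤ dirichletEigenvalue k := by
    intro k
    obtain ⟨h1, h2⟩ := mem_laplacianGraph.1 (hp k)
    have h := h1.inner_eq h2
    rw [real_inner_self_eq_norm_sq, real_inner_smul_left, real_inner_self_eq_norm_sq,
      orthonormal_dirichletEigenfunction.1 k, one_pow, mul_one] at h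
    refine le_of_sq_le_sq ?_ (dirichletEigenvalue_pos k).le
    rw [h]
    exact le_self_pow₀ (one_le_dirichletEigenvalue k) two_ne_zero
  have hb := summable_heatSemigroupLaplacian_bound t z
  have hle := fun k => abs_heatSemigroupLaplacian_coeff_le ht le_rfl z k
  set a : ℕ → ℝ := fun k => Real.exp (-dirichletEigenvalue k * t) * dirichletCoeff k z with ha
  have hs1 : HasSum (fun k => a k • dirichletEigenfunction k) (heatSemigroup t z) :=
    heatSemigroup_hasSum t ht.le z
  have hs2 : Summable (fun k => a k • p k) := by
    refine Summable.of_norm_bounded hb fun k => ?_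
    refine le_trans ?_ (hle k)
    rw [norm_smul, mul_assoc, abs_mul, abs_of_pos (dirichletEigenvalue_pos k), mul_comm,
      Real.norm_eq_abs]
    exact mul_le_mul_of_nonneg_right (hnp k) (abs_nonneg _)
  have hs3 : HasSum (fun k => a k • dirichletEigenvalue k • dirichletEigenfunction k)
      (heatSemigroupLaplacian t z) := by
    have : Summable (fun k => (dirichletEigenvalue k * Real.exp (-dirichletEigenvalue k * t) *
        dirichletCoeff k z) • dirichletEigenfunction k) := by
      refine Summable.of_norm_bounded hb fun k => ?_
      rw [norm_smul_dirichletEigenfunction]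
      exact hle k
    refine this.hasSum.congr_fun fun k => ?_
    rw [smul_smul, ha]
    congr 1
    ring
  rw [mem_dirichletLaplacian_iff]
  refine ⟨∑' k, a k • p k, ?_⟩
  refine isClosed_laplacianGraph.mem_of_tendsto (hs1.prodMk (hs2.hasSum.prodMk hs3))
    (Eventually.of_forall fun s => ?_)
  exact Submodule.sum_mem _ fun k _ => laplacianGraph.smul_mem (a k) (hp k)

/-- Affine solutions of the inclusion, along which the right-hand side is stationary. -/
theorem isStrongSolution_add_heatSemigroup {v g z : L2} (hg : g ∈ dirichletLaplacian v)
    (hz : Summable fun k => |dirichletCoeff k z|)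
    (hmem : ∀ t, 0 ≤ t → g ∈ subdiffPsi2 (v + heatSemigroup t z)) :
    IsStrongSolution (fun t => v + heatSemigroup t z) (v + z) := by
  refine ⟨continuousOn_const.add (continuousOn_heatSemigroup hz), ?_, ?_,
    fun _ => g, ?_, ?_, ?_⟩
  · simp only [heatSemigroup_zero_time]
  · intro T₁ T₂ h1 h12
    -- On `[T₁, T₂]` the time derivative is bounded by its majorant at `T₁`, so the solution is
    -- Lipschitz there.
    set C := ∑' k, 2 / T₁ ^ 2 * (dirichletEigenvalue k)⁻¹ * ‖z‖
    refine LipschitzOnWith.absolutelyContinuousOnInterval (K := C.toNNReal) ?_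
    rw [uIcc_of_le h12]
    refine (convex_Icc T₁ T₂).lipschitzOnWith_of_nnnorm_hasDerivWithin_le
      (f' := fun t => -heatSemigroupLaplacian t z) ?_ ?_
    · intro t ht
      exact ((hasDerivAt_heatSemigroup (h1.trans_le ht.1) z).const_add v).hasDerivWithinAt
    · intro t ht
      rw [nnnorm_neg]
      exact NNReal.le_toNNReal_of_coe_le (norm_heatSemigroupLaplacian_le h1 ht.1 z)
  · exact fun _ _ _ _ => memLp_const g
  · exact (ae_restrict_iff' measurableSet_Ioi).2
      (Eventually.of_forall fun t ht => hmem t (le_of_lt ht))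
  · refine (ae_restrict_iff' measurableSet_Ioi).2 (Eventually.of_forall fun t ht => ?_)
    refine ⟨_, dirichletLaplacian_add hg (heatSemigroupLaplacian_mem ht z), ?_⟩
    rw [sub_add_cancel_left]
    exact (hasDerivAt_heatSemigroup ht z).const_add v

/-- `D(A_H) ⊆ V_H^{2r}` for `r ≤ 1`. -/
theorem mem_VH_of_dirichletLaplacian {v y : L2} (h : y ∈ dirichletLaplacian v) {r : ℝ}
    (hr : r ≤ 1) : v ∈ VH r := by
  rw [mem_VH_iff]
  refine (hasSum_dirichletCoeff_sq y).summable.of_nonneg_of_le (fun k => sq_nonneg _) fun k => ?_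
  -- Testing with `eₖ` gives `μₖ (v, eₖ) = (y, eₖ)`, and `μₖ^r ≤ μₖ` because `μₖ ≥ 1`.
  have hs := dirichletLaplacian_symm (dirichletEigenfunction_mem k) h
  rw [real_inner_smul_left] at hs
  change dirichletEigenvalue k * dirichletCoeff k v = dirichletCoeff k y at hs
  rw [← hs, mul_pow, mul_pow]
  gcongr
  · exact Real.rpow_nonneg (dirichletEigenvalue_pos k).le _
  · calc _ ≤ dirichletEigenvalue k ^ (1 : ℝ) :=
          Real.rpow_le_rpow_of_exponent_le (one_le_dirichletEigenvalue k) hr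
      _ = _ := Real.rpow_one _

/-! ### Uniqueness for solutions that stay away from zero -/

theorem absolutelyContinuousOnInterval_norm {F : Type*}
    [SeminormedAddCommGroup F] {f : ℝ → F} {a b : ℝ} (h : AbsolutelyContinuousOnInterval f a b) :
    AbsolutelyContinuousOnInterval (fun t => ‖f t‖) a b := by
  rw [absolutelyContinuousOnInterval_iff] at h ⊢
  intro ε hε
  obtain ⟨δ, hδ, H⟩ := h ε hε
  refine ⟨δ, hδ, fun E hE hlt => (Finset.sum_le_sum fun i _ => ?_).trans_lt (H E hE hlt)⟩
  rw [Real.dist_eq, dist_eq_norm (f _)]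
  exact abs_norm_sub_norm_le _ _

/-- Grönwall's inequality for functions that are absolutely continuous on `(0, ∞)`. -/
theorem eq_zero_of_ae_deriv_le {f : ℝ → ℝ} {C : ℝ} (hc : ContinuousOn f (Ici 0))
    (hac : ∀ a b : ℝ, 0 < a → a ≤ b → AbsolutelyContinuousOnInterval f a b)
    (h0 : f 0 = 0) (hf : ∀ t, 0 ≤ f t)
    (hd : ∀ᵐ t ∂(volume.restrict (Ioi (0 : ℝ))), ∃ f', HasDerivAt f f' t ∧ f' ≤ C * f t)
    {t : ℝ} (ht : 0 ≤ t) : f t = 0 := by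
  set h : ℝ → ℝ := fun s => Real.exp (-C * s) * f s with hh
  have hE : ∀ s, HasDerivAt (fun s => Real.exp (-C * s)) (Real.exp (-C * s) * -C) s := fun s => by
    have h1 : HasDerivAt (fun s => -C * s) (-C) s := by
      simpa using (hasDerivAt_id s).const_mul (-C)
    exact h1.exp
  have hmono : ∀ a b, 0 < a → a ≤ b → h b ≤ h a := by
    intro a b ha hab
    have hE' : ContDiff ℝ 1 fun s : ℝ => Real.exp (-C * s) := by fun_prop
    have hach : AbsolutelyContinuousOnInterval h a b :=
      (hE'.contDiffOn.absolutelyContinuousOnInterval).mul (hac a b ha hab)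
    rw [← sub_nonpos, ← hach.integral_deriv_eq_sub, intervalIntegral.integral_of_le hab]
    refine integral_nonpos_of_ae ?_
    have hsub : Ioc a b ⊆ Ioi 0 := fun x hx => ha.trans hx.1
    filter_upwards [ae_restrict_of_ae_restrict_of_subset hsub hd] with s hs
    obtain ⟨f', hf', hle⟩ := hs
    have hder : deriv h s = _ := ((hE s).mul hf').deriv
    rw [hder]
    have := mul_le_mul_of_nonneg_left hle (Real.exp_pos (-C * s)).le
    simp only [Pi.zero_apply]
    linarith
  rcases ht.eq_or_lt with rfl | htpos
  · exact h0
  -- Absolute continuity holds only away from `0`; continuity carries the monotonicity to the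
  -- initial time.
  have hlim : Tendsto h (𝓝[>] 0) (𝓝 (h 0)) := by
    have : ContinuousOn h (Ici 0) :=
      ContinuousOn.mul (Continuous.continuousOn (by fun_prop)) hc
    exact (this 0 self_mem_Ici).mono_left (nhdsWithin_mono _ Ioi_subset_Ici_self)
  have hle : h t ≤ h 0 := by
    refine ge_of_tendsto hlim ?_
    filter_upwards [Ioo_mem_nhdsGT htpos] with s hs
    exact hmono s t hs.1 hs.2.le
  simp only [hh, h0, mul_zero] at hle
  exact le_antisymm (nonpos_of_mul_nonpos_right hle (Real.exp_pos _)) (hf t)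

/-! ### One-sided estimates for the Heaviside term -/

theorem heaviside_of_pos {s : ℝ} (hs : 0 < s) : heaviside s = {1} := by
  simp [heaviside, hs.not_gt, hs.ne']

theorem heaviside_of_neg {s : ℝ} (hs : s < 0) : heaviside s = {-1} := by
  simp [heaviside, hs]

theorem heaviside_subset_Icc (s : ℝ) : heaviside s ⊆ Icc (-1) 1 := by
  unfold heaviside
  split_ifs <;> simp

theorem heaviside_neg (s : ℝ) : heaviside (-s) = -heaviside s := by
  rcases lt_trichotomy s 0 with h | rfl | h
  · rw [heaviside_of_neg h, heaviside_of_pos (neg_pos.2 h)]; simp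
  · simp [heaviside]
  · rw [heaviside_of_pos h, heaviside_of_neg (neg_lt_zero.2 h)]; simp

/-- The product vanishes unless `s₁ ≤ 0`. In that case `|s₁ - s₂| ≥ m`, so the linear bound `2|s₁ -
s₂|` becomes quadratic at the price of a factor `1/m`. -/
theorem sub_mul_sub_le_of_heaviside {s₁ s₂ y₁ y₂ m : ℝ} (h₁ : y₁ ∈ heaviside s₁)
    (h₂ : y₂ ∈ heaviside s₂) (hm : 0 < m) (hs : m ≤ s₂) :
    (y₁ - y₂) * (s₁ - s₂) ≤ 2 / m * (s₁ - s₂) ^ 2 := by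
  have e₂ : y₂ = 1 := by
    rw [heaviside_of_pos (hm.trans_le hs)] at h₂
    exact h₂
  subst e₂
  rcases lt_or_ge 0 s₁ with hpos | hneg
  · rw [heaviside_of_pos hpos] at h₁
    rw [mem_singleton_iff.1 h₁, sub_self, zero_mul]
    positivity
  · obtain ⟨l, -⟩ := heaviside_subset_Icc _ h₁
    have hw : m ≤ s₂ - s₁ := by linarith
    have h1 : (y₁ - 1) * (s₁ - s₂) ≤ 2 * (s₂ - s₁) := by nlinarith
    have h2 : 2 * (s₂ - s₁) ≤ 2 * ((s₂ - s₁) * ((s₂ - s₁) / m)) := by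
      have : 1 ≤ (s₂ - s₁) / m := (one_le_div hm).2 hw
      have h0 : 0 ≤ s₂ - s₁ := hm.le.trans hw
      nlinarith
    calc _ ≤ _ := h1.trans h2
      _ = _ := by ring

theorem min_le_two_mul {x : ℝ} (hx : x ∈ Ioo (0 : ℝ) 1) : min x (1 - x) ≤ 2 * (x * (1 - x)) := by
  have h0 := hx.1
  have h1 := hx.2
  rcases min_cases x (1 - x) with ⟨e, h⟩ | ⟨e, h⟩ <;> rw [e] <;> nlinarith

theorem measureReal_boundary_layer_le {η : ℝ} (hη : 0 < η) :
    leb01.real {x | min x (1 - x) < η} ≤ 2 * η := by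
  have hsub : {x : ℝ | min x (1 - x) < η} ∩ Ioo 0 1 ⊆ Ioo 0 η ∪ Ioo (1 - η) 1 := by
    rintro x ⟨hx, h0, h1⟩
    rcases min_lt_iff.1 (show min x (1 - x) < η from hx) with h | h
    · exact Or.inl ⟨h0, h⟩
    · exact Or.inr ⟨by linarith, h1⟩
  rw [measureReal_restrict_apply' measurableSet_Ioo]
  refine (measureReal_mono hsub
    (measure_union_ne_top measure_Ioo_lt_top.ne measure_Ioo_lt_top.ne)).trans
    ((measureReal_union_le _ _).trans ?_)
  rw [Real.volume_real_Ioo_of_le hη.le, Real.volume_real_Ioo_of_le (by linarith)]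
  linarith

/-- The reaction term is controlled by the energy when one of the functions is bounded below by
a multiple of `x (1 - x)`. -/
theorem inner_sub_le_of_subdiffPsi2 {u₁ u₂ g₁ g₂ p : L2} {c : ℝ} (hc : 0 < c)
    (h₁ : g₁ ∈ subdiffPsi2 u₁) (h₂ : g₂ ∈ subdiffPsi2 u₂)
    (hu₂ : ∀ᵐ x ∂leb01, c * (x * (1 - x)) ≤ u₂ x) (hp : HasWeakDerivH10 (u₁ - u₂) p) :
    inner ℝ (u₁ - u₂) (g₁ - g₂) ≤ ‖p‖ ^ 2 + 32 / c ^ 2 * ‖u₁ - u₂‖ ^ 2 := by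
  set w := u₁ - u₂ with hw
  -- Chosen so that `2η · (4/c) = 1`: the boundary layer then costs exactly `‖p‖²`, and `4/(cη)`
  -- equals `32/c²`.
  set η := c / 8 with hη
  have hηpos : 0 < η := by positivity
  set S : Set ℝ := {x | min x (1 - x) < η} with hS
  have hSm : MeasurableSet S := measurableSet_lt (by fun_prop) measurable_const
  have hint1 : Integrable (S.indicator fun _ => 4 / c * ‖p‖ ^ 2) leb01 :=
    (integrable_const _).indicator hSm
  have hint2 : Integrable (fun x => 4 / (c * η) * w x ^ 2) leb01 :=
    (integrable_sq_L2 w).const_mul _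
  rw [L2.inner_def]
  calc ∫ x, inner ℝ (w x) ((g₁ - g₂) x) ∂leb01
      ≤ ∫ x, (S.indicator (fun _ => 4 / c * ‖p‖ ^ 2) x + 4 / (c * η) * w x ^ 2) ∂leb01 := by
        refine integral_mono_ae (L2.integrable_inner w (g₁ - g₂)) (hint1.add hint2) ?_
        filter_upwards [h₁, h₂, hu₂, hp.sq_le, Lp.coeFn_sub u₁ u₂, Lp.coeFn_sub g₁ g₂,
          ae_restrict_mem measurableSet_Ioo] with x k₁ k₂ k₃ k₄ k₅ k₆ hx
        have hd : 0 < x * (1 - x) := mul_pos hx.1 (sub_pos.2 hx.2)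
        have hm : 0 < min x (1 - x) := lt_min hx.1 (sub_pos.2 hx.2)
        have hmd := min_le_two_mul hx
        have e : inner ℝ (w x) ((g₁ - g₂) x) = (g₁ x - g₂ x) * (u₁ x - u₂ x) := by
          rw [k₆, k₅]; simp
        have hwx : w x = u₁ x - u₂ x := k₅
        have hb := sub_mul_sub_le_of_heaviside k₁ k₂ (mul_pos hc hd) k₃
        rw [← hwx] at hb e
        have hb' : 2 / (c * (x * (1 - x))) * w x ^ 2 ≤ 4 / (c * min x (1 - x)) * w x ^ 2 := by
          refine mul_le_mul_of_nonneg_right ?_ (sq_nonneg _)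
          rw [div_le_div_iff₀ (by positivity) (by positivity)]
          nlinarith
        simp only [e]
        refine hb.trans (hb'.trans ?_)
        -- In the layer the square-root decay of `H¹₀` functions cancels the singular weight;
        -- outside it the weight is at most `4/(cη)`.
        by_cases hxS : x ∈ S
        · rw [indicator_of_mem hxS]
          refine le_add_of_le_of_nonneg ?_ (by positivity)
          calc 4 / (c * min x (1 - x)) * w x ^ 2
              ≤ 4 / (c * min x (1 - x)) * (min x (1 - x) * ‖p‖ ^ 2) := by gcongr
            _ = 4 / c * ‖p‖ ^ 2 := by field_simp
        · rw [indicator_of_notMem hxS, zero_add]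
          have : η ≤ min x (1 - x) := not_lt.1 hxS
          gcongr
    _ = leb01.real S * (4 / c * ‖p‖ ^ 2) + 4 / (c * η) * ‖w‖ ^ 2 := by
        rw [integral_add hint1 hint2, integral_indicator_const _ hSm, integral_const_mul,
          norm_sq_L2 w, smul_eq_mul]
    _ ≤ 2 * η * (4 / c * ‖p‖ ^ 2) + 4 / (c * η) * ‖w‖ ^ 2 := by
        gcongr
        exact measureReal_boundary_layer_le hηpos
    _ = _ := by
        rw [hη]
        field_simp
        ring

/-- A strong solution that stays above a positive multiple of `x (1 - x)` is the only one with
its initial value. -/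
theorem IsStrongSolution.eq_of_lower_bound {u₁ u₂ : ℝ → L2} {u₀ : L2}
    (h₁ : IsStrongSolution u₁ u₀) (h₂ : IsStrongSolution u₂ u₀) {c : ℝ} (hc : 0 < c)
    (hlow : ∀ t, 0 ≤ t → ∀ᵐ x ∂leb01, c * (x * (1 - x)) ≤ u₂ t x) {t : ℝ} (ht : 0 ≤ t) :
    u₁ t = u₂ t := by
  obtain ⟨c₁, i₁, a₁, g₁, -, m₁, d₁⟩ := h₁
  obtain ⟨c₂, i₂, a₂, g₂, -, m₂, d₂⟩ := h₂
  have key := eq_zero_of_ae_deriv_le (f := fun t => ‖u₁ t - u₂ t‖ ^ 2)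
    (C := 2 * (32 / c ^ 2)) ((c₁.sub c₂).norm.pow 2) ?_ (by simp [i₁, i₂])
    (fun _ => sq_nonneg _) ?_ ht
  · exact sub_eq_zero.1 (norm_eq_zero.1 (pow_eq_zero_iff two_ne_zero |>.1 key))
  · intro a b ha hab
    have hn := absolutelyContinuousOnInterval_norm ((a₁ a b ha hab).sub (a₂ a b ha hab))
    simpa only [← sq, Pi.sub_apply] using hn.fun_mul hn
  · filter_upwards [m₁, m₂, d₁, d₂, ae_restrict_mem measurableSet_Ioi] with s m₁ m₂ d₁ d₂ hs
    obtain ⟨y₁, hy₁, e₁⟩ := d₁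
    obtain ⟨y₂, hy₂, e₂⟩ := d₂
    obtain ⟨p, hp, hpy⟩ := dirichletLaplacian_sub hy₁ hy₂
    -- The dissipation equals `‖p‖²`, so it cancels the `‖p‖²` allowed in the bound of the reaction
    -- term.
    have hen := hp.inner_eq hpy
    rw [real_inner_self_eq_norm_sq, real_inner_comm] at hen
    have hle := inner_sub_le_of_subdiffPsi2 hc m₁ m₂ (hlow s (le_of_lt hs)) hp
    refine ⟨_, (e₁.sub e₂).norm_sq, ?_⟩
    have e : g₁ s - y₁ - (g₂ s - y₂) = (g₁ s - g₂ s) - (y₁ - y₂) := by abel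
    rw [Pi.sub_apply, e, inner_sub_right]
    linarith

/-! ### The fixed points `v₁⁺` and `v₁⁻` -/

/-- The constant function `1`. -/
def oneL2 : L2 := toL2 (fun _ => 1) continuous_const

theorem oneL2_mem_dirichletLaplacian : oneL2 ∈ dirichletLaplacian v1Plus := by
  have d1 : ∀ x : ℝ, HasDerivAt (fun x : ℝ => -x ^ 2 / 2 + x / 2) (-x + 1 / 2) x := fun x => by
    convert! (((hasDerivAt_pow 2 x).neg.div_const 2).add ((hasDerivAt_id x).div_const 2)) using 1
    simp
    ring
  have d2 : ∀ x : ℝ, HasDerivAt (fun x : ℝ => -x + 1 / 2) (-1) x := fun x =>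
    ((hasDerivAt_id x).neg).add_const _
  have e : -oneL2 = toL2 (fun _ => -1) continuous_const :=
    (MemLp.toLp_neg (memLp_of_continuous continuous_const)).symm
  refine ⟨toL2 (fun x => -x + 1 / 2) (by fun_prop),
    hasWeakDerivH10_toL2 (by fun_prop) _ d1 (by simp) (by norm_num), ?_⟩
  rw [e]
  exact hasWeakDeriv_toL2 _ _ d2

theorem v1Plus_ae : ∀ᵐ x ∂leb01, v1Plus x = 1 / 2 * (x * (1 - x)) := by
  filter_upwards [toL2_ae (fun x => -x ^ 2 / 2 + x / 2) (by fun_prop)] with x hx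
  rw [v1Plus, hx]
  ring

theorem oneL2_mem_subdiffPsi2 {u : L2} (h : ∀ᵐ x ∂leb01, 0 < u x) : oneL2 ∈ subdiffPsi2 u := by
  change ∀ᵐ x ∂leb01, oneL2 x ∈ heaviside (u x)
  filter_upwards [h, toL2_ae (fun _ => (1 : ℝ)) continuous_const] with x hx h1
  rw [heaviside_of_pos hx, oneL2, h1]
  exact mem_singleton 1

theorem ae_pos_of_mul_le {u : L2} {c : ℝ} (hc : 0 < c)
    (h : ∀ᵐ x ∂leb01, c * (x * (1 - x)) ≤ u x) : ∀ᵐ x ∂leb01, 0 < u x := by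
  filter_upwards [h, ae_restrict_mem measurableSet_Ioo] with x hx hxI
  exact (mul_pos hc (mul_pos hxI.1 (sub_pos.2 hxI.2))).trans_le hx

theorem v1Plus_pos : ∀ᵐ x ∂leb01, 0 < v1Plus x :=
  ae_pos_of_mul_le one_half_pos (v1Plus_ae.mono fun _ h => h.ge)

theorem exists_v1Plus_add_lower_bound {r : ℝ} (hr : 3 / 4 < r) :
    ∃ δ : ℝ, 0 < δ ∧ ∀ z : VH r, normVH r z < δ →
      ∀ᵐ x ∂leb01, 1 / 4 * (x * (1 - x)) ≤ (v1Plus + z : L2) x := by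
  obtain ⟨K, hK, h⟩ := exists_ae_abs_le_normVH hr
  -- With this radius the perturbation is at most `x(1 - x)/4`, half of `v₁⁺`.
  have hδ : 0 < 1 / (4 * K) := by positivity
  refine ⟨1 / (4 * K), hδ, fun z hz => ?_⟩
  filter_upwards [h z _ hδ hz.le, v1Plus_ae, Lp.coeFn_add v1Plus (z : L2)] with x h1 h2 h3
  rw [h3, Pi.add_apply, h2]
  have e : K * (1 / (4 * K)) = 1 / 4 := by field_simp
  rw [e] at h1
  linarith [neg_le_of_abs_le h1]

theorem subdiffPsi2_neg {u y : L2} (h : y ∈ subdiffPsi2 u) : -y ∈ subdiffPsi2 (-u) := by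
  change ∀ᵐ x ∂leb01, (-y : L2) x ∈ heaviside ((-u : L2) x)
  filter_upwards [h, Lp.coeFn_neg y, Lp.coeFn_neg u] with x h1 h2 h3
  rw [h2, h3, Pi.neg_apply, Pi.neg_apply, heaviside_neg, Set.neg_mem_neg]
  exact h1

/-- `A_H` is linear and `H₀` is odd; this symmetry reduces `v₁⁻` to `v₁⁺`. -/
theorem IsStrongSolution.neg {u : ℝ → L2} {u₀ : L2} (h : IsStrongSolution u u₀) :
    IsStrongSolution (fun t => -u t) (-u₀) := by
  obtain ⟨hc, h0, ha, g, hg, hm, hd⟩ := h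
  refine ⟨hc.neg, by simp only [h0], fun a b h1 h2 => (ha a b h1 h2).neg, fun t => -g t,
    fun a b h1 h2 => (hg a b h1 h2).neg, hm.mono fun t ht => subdiffPsi2_neg ht,
    hd.mono fun t ht => ?_⟩
  obtain ⟨y, hy, hdy⟩ := ht
  refine ⟨-y, dirichletLaplacian_neg hy, ?_⟩
  rw [← neg_sub']
  exact hdy.neg

theorem isFixedPoint_v1Plus : IsFixedPoint v1Plus := by
  have h := isStrongSolution_add_heatSemigroup (z := 0) oneL2_mem_dirichletLaplacian
    (by simp [dirichletCoeff]) (fun t _ => by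
      rw [heatSemigroup_zero, add_zero]
      exact oneL2_mem_subdiffPsi2 v1Plus_pos)
  simp only [heatSemigroup_zero, add_zero] at h
  exact h

/-- Near `v` in `V_H^{2r}` the discontinuity is not felt, and the flow around `v` is the heat
flow. -/
def IsLocallyLinear (r : ℝ) (v : L2) (δ : ℝ) : Prop :=
  (∀ w ∈ ballVH r v δ, ∀ᵐ x ∂leb01, heaviside (w x) = heaviside (v x)) ∧
  ∀ z₀ : VH r, normVH r z₀ < δ →
    (∃ u : ℝ → L2, IsStrongSolution u (v + z₀)) ∧
    ∀ u : ℝ → L2, IsStrongSolution u (v + z₀) →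
      ∀ t : ℝ, 0 ≤ t → u t = v + heatSemigroup t z₀

theorem normVH_heatSemigroup_le_self {t r : ℝ} (ht : 0 ≤ t) (z : VH r) :
    normVH r ⟨heatSemigroup t z, heatSemigroup_mem_VH ht z.2⟩ ≤ normVH r z := by
  refine (normVH_heatSemigroup_le ht z).trans
    (mul_le_of_le_one_left (normVH_nonneg _ _) (Real.exp_le_one_iff.2 ?_))
  have := mul_nonneg (dirichletEigenvalue_pos 0).le ht
  linarith

theorem exists_isLocallyLinear_v1Plus {r : ℝ} (hr : 3 / 4 < r) :
    ∃ δ : ℝ, 0 < δ ∧ IsLocallyLinear r v1Plus δ := by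
  obtain ⟨δ, hδ, hlow⟩ := exists_v1Plus_add_lower_bound hr
  refine ⟨δ, hδ, ?_, fun z₀ hz₀ => ?_⟩
  · rintro _ ⟨z, rfl, hz⟩
    filter_upwards [ae_pos_of_mul_le (by norm_num) (hlow z hz), v1Plus_pos] with x h1 h2
    rw [heaviside_of_pos h1, heaviside_of_pos h2]
  · have hlow' : ∀ t, 0 ≤ t → ∀ᵐ x ∂leb01,
        1 / 4 * (x * (1 - x)) ≤ (v1Plus + heatSemigroup t z₀ : L2) x := fun t ht =>
      hlow ⟨heatSemigroup t z₀, heatSemigroup_mem_VH ht z₀.2⟩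
        ((normVH_heatSemigroup_le_self ht z₀).trans_lt hz₀)
    obtain ⟨K, -, hK⟩ := exists_tsum_le_normVH hr
    have hsum : Summable fun k => |dirichletCoeff k (z₀ : L2)| :=
      (hK z₀).1.of_nonneg_of_le (fun _ => abs_nonneg _) fun k =>
        le_mul_of_one_le_left (abs_nonneg _) (by simp)
    have hsol := isStrongSolution_add_heatSemigroup oneL2_mem_dirichletLaplacian hsum
      fun t ht => oneL2_mem_subdiffPsi2 (ae_pos_of_mul_le (by norm_num) (hlow' t ht))
    -- The lower bound is needed for the explicit solution only; the competitor `u` may be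
    -- arbitrary.
    exact ⟨⟨_, hsol⟩, fun u hu t ht => hu.eq_of_lower_bound hsol (by norm_num) hlow' ht⟩

theorem ballVH_neg {r δ : ℝ} {v w : L2} (h : w ∈ ballVH r (-v) δ) : -w ∈ ballVH r v δ := by
  obtain ⟨z, rfl, hz⟩ := h
  exact ⟨-z, by rw [Submodule.coe_neg, neg_add, neg_neg], by rwa [normVH_neg]⟩

theorem IsLocallyLinear.neg {r δ : ℝ} {v : L2} (h : IsLocallyLinear r v δ) :
    IsLocallyLinear r (-v) δ := by
  obtain ⟨h1, h2⟩ := h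
  refine ⟨fun w hw => ?_, fun z₀ hz₀ => ?_⟩
  · filter_upwards [h1 _ (ballVH_neg hw), Lp.coeFn_neg w, Lp.coeFn_neg v] with x e e1 e2
    rw [e1, Pi.neg_apply, heaviside_neg] at e
    rw [e2, Pi.neg_apply, heaviside_neg, ← e, neg_neg]
  · obtain ⟨⟨u, hu⟩, huniq⟩ := h2 (-z₀) (by rwa [normVH_neg])
    rw [Submodule.coe_neg] at hu huniq
    refine ⟨⟨fun t => -u t, ?_⟩, fun u' hu' t ht => ?_⟩
    · rw [show -v + (z₀ : L2) = -(v + -z₀) by rw [neg_add, neg_neg]]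
      exact hu.neg
    · have hu'' : IsStrongSolution (fun t => -u' t) (v + -z₀) := by
        rw [show v + -(z₀ : L2) = -(-v + z₀) by rw [neg_add, neg_neg]]
        exact hu'.neg
      have := huniq _ hu'' t ht
      rw [heatSemigroup_neg] at this
      rw [← neg_neg (u' t), this, neg_add, neg_neg]

/-! ### From local linearity to asymptotic stability -/

theorem IsLocallyLinear.exists_eq_add {r δ : ℝ} {v : L2} (h : IsLocallyLinear r v δ)
    {z₀ : VH r} (hz₀ : normVH r z₀ < δ) {u : ℝ → L2} (hu : IsStrongSolution u (v + z₀))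
    {t : ℝ} (ht : 0 ≤ t) :
    ∃ z : VH r, u t = v + z ∧ (z : L2) = heatSemigroup t z₀ ∧
      normVH r z ≤ Real.exp (-dirichletEigenvalue 0 * t) * normVH r z₀ :=
  ⟨⟨heatSemigroup t z₀, heatSemigroup_mem_VH ht z₀.2⟩, (h.2 z₀ hz₀).2 u hu t ht, rfl,
    normVH_heatSemigroup_le ht z₀⟩

theorem IsLocallyLinear.isStableVH {r δ : ℝ} {v : L2} (h : IsLocallyLinear r v δ)
    (hδ : 0 < δ) : IsStableVH r v := by
  intro ε hε
  refine ⟨min δ ε, lt_min hδ hε, ?_⟩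
  rintro _ ⟨z₀, rfl, hz₀⟩ u hu t ht
  have hu' := (h.2 z₀ (hz₀.trans_le (min_le_left _ _))).2 u hu t ht
  exact ⟨_, hu', (normVH_heatSemigroup_le_self ht z₀).trans_lt
    (hz₀.trans_le (min_le_right _ _))⟩

theorem IsLocallyLinear.isAttractiveVH {r δ : ℝ} {v : L2} (h : IsLocallyLinear r v δ)
    (hδ : 0 < δ) : IsAttractiveVH r v := by
  refine ⟨δ, hδ, ?_⟩
  rintro _ ⟨z₀, rfl, hz₀⟩ u hu ε hε
  have hlim : Tendsto (fun t => Real.exp (-dirichletEigenvalue 0 * t) * normVH r z₀) atTop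
      (𝓝 (0 * normVH r z₀)) := by
    refine (Real.tendsto_exp_atBot.comp ?_).mul_const _
    exact tendsto_id.const_mul_atTop_of_neg (neg_lt_zero.2 (dirichletEigenvalue_pos 0))
  rw [zero_mul] at hlim
  filter_upwards [hlim.eventually_lt_const hε, eventually_ge_atTop 0] with t h1 h2
  obtain ⟨z, e, -, hle⟩ := h.exists_eq_add hz₀ hu h2
  exact ⟨z, e, hle.trans_lt h1⟩

end DiscRD

end

theorem mainTheorem7 (r : ℝ) (hr₁ : 3 / 4 < r) (hr₂ : r < 1) (v : DiscRD.L2)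
    (hv : v = DiscRD.v1Plus ∨ v = DiscRD.v1Minus) :
    DiscRD.IsAsymptoticallyStableVH r v ∧
    ∃ δ M : ℝ, 0 < δ ∧ 1 ≤ M ∧
      (∀ w ∈ DiscRD.ballVH r v δ,
        ∀ᵐ x ∂DiscRD.leb01, DiscRD.heaviside (w x) = DiscRD.heaviside (v x)) ∧
      ∀ z₀ : DiscRD.VH r, DiscRD.normVH r z₀ < δ →
        (∃ u : ℝ → DiscRD.L2, DiscRD.IsStrongSolution u (v + z₀)) ∧
        ∀ u : ℝ → DiscRD.L2, DiscRD.IsStrongSolution u (v + z₀) →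
          ∀ t : ℝ, 0 ≤ t → ∃ z : DiscRD.VH r,
            u t = v + z ∧ (z : DiscRD.L2) = DiscRD.heatSemigroup t z₀ ∧
            DiscRD.normVH r z ≤
              M * Real.exp (-DiscRD.dirichletEigenvalue 0 * t) * DiscRD.normVH r z₀ := by
  obtain ⟨δ, hδ, hloc⟩ := DiscRD.exists_isLocallyLinear_v1Plus hr₁
  have hVH := DiscRD.mem_VH_of_dirichletLaplacian DiscRD.oneL2_mem_dirichletLaplacian hr₂.le
  have hfix := DiscRD.isFixedPoint_v1Plus
  have key : DiscRD.IsFixedPoint v ∧ v ∈ DiscRD.VH r ∧ DiscRD.IsLocallyLinear r v δ := by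
    rcases hv with rfl | rfl
    · exact ⟨hfix, hVH, hloc⟩
    · exact ⟨hfix.neg, Submodule.neg_mem _ hVH, hloc.neg⟩
  obtain ⟨kfix, kVH, kloc⟩ := key
  -- `M = 1` suffices, because the semigroup and the norm are diagonal in the same eigenbasis.
  refine ⟨⟨kfix, kVH, kloc.isStableVH hδ, kloc.isAttractiveVH hδ⟩, δ, 1, hδ, le_rfl, kloc.1,
    fun z₀ hz₀ => ⟨(kloc.2 z₀ hz₀).1, fun u hu t ht => ?_⟩⟩
  rw [one_mul]
  exact kloc.exists_eq_add hz₀ hu ht
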